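/- Let $D\subset\mathbb C$ be a bounded Jordan domain with $0\in D$ whose boundary $\eta=\partial D$ (a Jordan curve) has zero area, and let $D^*=\mathbb C\smallsetminus\overline D$. Write $\mathbb D=\{|z|<1\}$ and $\mathbb D^*=\{|z|>1\}$. Let $f:\mathbb D\to D$ be the conformal map with $f(0)=0$ and $r_0=f'(0)>0$, and let $g:\mathbb D^*\to D^*$ be the conformal map with $g(z)=r_\infty z+\sum_{k\ge0}g_kz^{-k}$ and $r_\infty>0$. Define the Grunsky coefficients by $$\log\frac{g(\zeta)-g(z)}{r_\infty(\zeta-z)}=-\sum_{k,\ell\ge1}a_{k,\ell}\,\zeta^{-k}z^{-\ell}\quad(|\zeta|,|z|>1),\qquad \log\frac{f(\zeta)-f(z)}{\zeta-z}=-\sum_{k,\ell\ge0}a_{-k,-\ell}\,\zeta^{k}z^{\ell}\quad(|\zeta|,|z|<1),$$ where the logarithms are the continuous branches that vanish at $\zeta=z=\infty$ and equal $\log r_0\in\mathbb R$ at $\zeta=z=0$, respectively. For $n\ge1$ set $$Z_n(D)=\frac1{n!}\int_{D^n}\prod_{1\le k<\ell\le n}|z_k-z_\ell|^2\prod_{k=1}^nd^2z_k,\qquad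 Z_n^*(D^*)=\frac1{n!}\int_{(D^*)^n}e^{-(n+1)\sum_{k=1}^n\log|z_k|^2}\prod_{1\le k<\ell\le n}|z_k-z_\ell|^2\prod_{k=1}^nd^2z_k .$$ Then the matrices $B=(\sqrt{k\ell}\,a_{k,\ell})_{k,\ell\ge1}$ and $B_1=(\sqrt{k\ell}\,a_{-k,-\ell})_{k,\ell\ge1}$ define bounded operators on $\ell^2(\mathbb Z_+)$. If $P_n$ denotes the orthogonal projection of $\ell^2(\mathbb Z_+)$ onto the first $n$ coordinates, then for every $n\ge1$ both integrals converge, both partition functions and both determinants below are positive, and $$\log Z_n(D)=\log\frac{\pi^n}{n!}+n(n+1)\log r_\infty+\log\det(I-P_nBB^*P_n)_{\ell^2(\mathbb Z_+)},$$ $$\log Z_n^*(D^*)=\log\frac{\pi^n}{n!}-n(n+1)\log r_0+\log\det(I-P_nB_1B_1^*P_n)_{\ell^2(\mathbb Z_+)}.$$ -/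

import Mathlib

open MeasureTheory

/-- A bounded Jordan domain: a bounded, connected, open subset of the plane whose boundary is a
Jordan curve, i.e. the image of the circle under a continuous injective map. Equivalently, the
bounded component of the complement of a Jordan curve. -/
def IsBoundedJordanDomain (D : Set ℂ) : Prop :=
  IsOpen D ∧ IsConnected D ∧ Bornology.IsBounded D ∧
    ∃ γ : Circle → ℂ, Continuous γ ∧ Function.Injective γ ∧ Set.range γ = frontier D

/-- The exterior domain `D^*` (without the point at infinity). -/
def exteriorDomain (D : Set ℂ) : Set ℂ := (closure D)ᶜ

/-- `f` is the conformal map of the unit disc onto `D` with `f 0 = 0` and `f' 0 = r₀ > 0`;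
the number `r₀` is the conformal radius of `D` with respect to `0`. -/
structure IsInteriorConformalMap (D : Set ℂ) (f : ℂ → ℂ) (r₀ : ℝ) : Prop where
  differentiableOn : DifferentiableOn ℂ f (Metric.ball 0 1)
  injOn : Set.InjOn f (Metric.ball 0 1)
  image_eq : f '' Metric.ball 0 1 = D
  map_zero : f 0 = 0
  hasDerivAt_zero : HasDerivAt f (r₀ : ℂ) 0
  pos : 0 < r₀

/-- `g` is the conformal map of `{|z| > 1}` onto `D^*` with expansion
`g z = r z + c₀ + c₁ / z + c₂ / z ^ 2 + ⋯`, `r > 0`; the number `r` is the capacity of `D`. -/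
structure IsExteriorConformalMap (D : Set ℂ) (g : ℂ → ℂ) (r : ℝ) : Prop where
  differentiableOn : DifferentiableOn ℂ g {z | 1 < ‖z‖}
  injOn : Set.InjOn g {z | 1 < ‖z‖}
  image_eq : g '' {z | 1 < ‖z‖} = exteriorDomain D
  expansion : ∃ c : ℕ → ℂ, ∀ z : ℂ, 1 < ‖z‖ →
    HasSum (fun k : ℕ => c k * z⁻¹ ^ k) (g z - r * z)
  pos : 0 < r

/-- The coefficients `a k l`, `k, l ≥ 1`, of the expansion
`log ((g ζ - g z) / (r (ζ - z))) = - ∑ a k l ζ ^ (-k) z ^ (-l)` on `|ζ|, |z| > 1`.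
The sum of the series is a continuous logarithm that vanishes at infinity, so that the branch
and the coefficients are determined. -/
def IsExteriorGrunskyCoeff (g : ℂ → ℂ) (r : ℝ) (a : ℕ+ → ℕ+ → ℂ) : Prop :=
  ∀ ζ z : ℂ, 1 < ‖ζ‖ → 1 < ‖z‖ → ζ ≠ z →
    ∃ L : ℂ,
      HasSum (fun p : ℕ+ × ℕ+ => -(a p.1 p.2 * ζ⁻¹ ^ (p.1 : ℕ) * z⁻¹ ^ (p.2 : ℕ))) L ∧
      Complex.exp L = (g ζ - g z) / (r * (ζ - z))

/-- The coefficients `a k l` (written `a_{-k,-l}` in the literature), `k, l ≥ 0`, of the expansion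
`log ((f ζ - f z) / (ζ - z)) = - ∑ a k l ζ ^ k z ^ l` on `|ζ|, |z| < 1`; the branch of the
logarithm is the one that is real at `ζ = z = 0`, where its value is `log r₀ = log f' 0`. -/
def IsInteriorGrunskyCoeff (f : ℂ → ℂ) (r₀ : ℝ) (a : ℕ → ℕ → ℂ) : Prop :=
  a 0 0 = -(Real.log r₀ : ℂ) ∧
  ∀ ζ z : ℂ, ‖ζ‖ < 1 → ‖z‖ < 1 → ζ ≠ z →
    ∃ L : ℂ,
      HasSum (fun p : ℕ × ℕ => -(a p.1 p.2 * ζ ^ p.1 * z ^ p.2)) L ∧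
      Complex.exp L = (f ζ - f z) / (ζ - z)

/-- The Hilbert space `ℓ²(ℤ₊)`, with coordinates numbered `1, 2, 3, …`. -/
abbrev EllTwo : Type := lp (fun _ : ℕ+ => ℂ) 2

/-- The standard basis vector `e_k` of `ℓ²(ℤ₊)`. -/
noncomputable def ellBasis (k : ℕ+) : EllTwo := lp.single 2 k (1 : ℂ)

/-- The bounded operator `B` on `ℓ²(ℤ₊)` has the matrix `(√(k l) a k l)`, `k, l ≥ 1`. -/
def IsGrunskyOperator (a : ℕ+ → ℕ+ → ℂ) (B : EllTwo →L[ℂ] EllTwo) : Prop :=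
  ∀ k l : ℕ+, B (ellBasis l) k = (Real.sqrt ((k : ℝ) * (l : ℝ)) : ℂ) * a k l

/-- `P_n`: the orthogonal projection of `ℓ²(ℤ₊)` onto the first `n` coordinates. -/
noncomputable def truncProj (n : ℕ) : EllTwo →L[ℂ] EllTwo :=
  ∑ k ∈ Finset.range n,
    InnerProductSpace.rankOne ℂ (ellBasis k.succPNat) (ellBasis k.succPNat)

/-- `det(I - T)` for an operator `T` of finite rank: the determinant of `I - T` on the
(finite-dimensional, invariant) range of `T`. -/
noncomputable def detOneSub {E : Type*} [AddCommGroup E] [Module ℂ E] [TopologicalSpace E]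
    (T : E →L[ℂ] E) : ℂ :=
  LinearMap.det
    (LinearMap.id - (T : E →ₗ[ℂ] E).restrict
      (p := LinearMap.range (T : E →ₗ[ℂ] E)) (q := LinearMap.range (T : E →ₗ[ℂ] E))
      (fun x _ => LinearMap.mem_range_self (T : E →ₗ[ℂ] E) x))

/-- `det(I - P_n B B^* P_n)` on `ℓ²(ℤ₊)`. -/
noncomputable def truncDet (n : ℕ) (B : EllTwo →L[ℂ] EllTwo) : ℂ :=
  detOneSub (truncProj n ∘L B ∘L ContinuousLinearMap.adjoint B ∘L truncProj n)

/-- `∏_{k < l} |z_k - z_l|²`. -/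
noncomputable def coulombWeight (n : ℕ) (z : Fin n → ℂ) : ℝ :=
  ∏ k : Fin n, ∏ l ∈ Finset.Ioi k, ‖z k - z l‖ ^ 2

/-- `exp (-(n + 1) ∑_k log |z_k|²) ∏_{k < l} |z_k - z_l|²`. -/
noncomputable def exteriorCoulombWeight (n : ℕ) (z : Fin n → ℂ) : ℝ :=
  Real.exp (-((n : ℝ) + 1) * ∑ k : Fin n, Real.log (‖z k‖ ^ 2)) * coulombWeight n z

/-- The product set `Ω^n` in `ℂ^n`. -/
def configSpace (n : ℕ) (Ω : Set ℂ) : Set (Fin n → ℂ) := {z | ∀ k, z k ∈ Ω}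

/-- The partition function `Z_n(D)` of the Coulomb gas on `D` at inverse temperature `2`. -/
noncomputable def partitionFn (n : ℕ) (D : Set ℂ) : ℝ :=
  1 / (n.factorial : ℝ) * ∫ z in configSpace n D, coulombWeight n z

/-- The partition function `Z_n^*(Ω)` of the exterior Coulomb gas, for `Ω = D^*`. -/
noncomputable def exteriorPartitionFn (n : ℕ) (Ω : Set ℂ) : ℝ :=
  1 / (n.factorial : ℝ) * ∫ z in configSpace n Ω, exteriorCoulombWeight n z

/-!
Let `g z = r z + c₀ + c₁ / z + ⋯` be univalent on `{|z| > 1}`, and let `K` be the complement of its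
image. Its Faber polynomials satisfy `Fₘ (g z) = z ^ m + ∑ₙ bₘₙ z ^ (-n)`. Green's formula on the
set enclosed by the curve `g {|z| = ρ}` and Parseval's identity on `{|z| = ρ}` turn the inner
products of the `Fₘ'` into series in `bₘₙ`; as `ρ → 1`, the Gram matrix of `F₁', …, Fₙ'` in `L²(K)`
becomes `π (diag (k) - (∑ⱼ j bₖⱼ conj bₗⱼ))`. Since `bₘⱼ = m aₘⱼ` for the Grunsky coefficients `a`,
dividing by `π √(k l)` leaves `I - Pₙ B B* Pₙ`. Positivity of Gram matrices is the contractivity of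
`B`.

Passing from the `Fₘ'` to the monomials is a triangular change of basis with known diagonal, so the
determinant of the Gram matrix is an explicit multiple of the determinant of the moments of `K`,
which is `Zₙ` by Andréief's identity. The boundary is null, so `K` may be replaced by `D`. The
exterior partition function of `D*` is the interior one of its image under `z ↦ 1 / z`, to which
the same argument applies with `g z = 1 / f (1 / z)`, whose leading coefficient is `1 / r₀`.
-/

namespace Grunsky

open Complex Set Metric Filter
open scoped Real Topology ComplexConjugate

/-! ### Green's formula outside a disc -/

section Green

/-- The operator `V ↦ 2i ∂V/∂z̄`. The factor `2i` makes Green's formula read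
`∫_Ω dbar V = ∮_{∂Ω} V dz`. -/
noncomputable def dbar (V : ℂ → ℂ) (z : ℂ) : ℂ := I * fderiv ℝ V z 1 - fderiv ℝ V z I

variable {V W h u p q : ℂ → ℂ} {a z : ℂ}

theorem dbar_congr (hVW : V =ᶠ[𝓝 z] W) : dbar V z = dbar W z := by
  simp only [dbar, hVW.fderiv_eq]

theorem continuousAt_dbar (hV : ContDiffAt ℝ 1 V z) : ContinuousAt (dbar V) z := by
  have hV' : ContinuousAt (fderiv ℝ V) z :=
    (hV.fderiv_right (m := 0) (by norm_num)).continuousAt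
  unfold dbar
  fun_prop

theorem dbar_mul_comp (hu : DifferentiableAt ℂ u z) (hh : HasDerivAt h a z)
    (hW : DifferentiableAt ℝ W (h z)) :
    dbar (fun ζ => u ζ * W (h ζ)) z = u z * conj a * dbar W (h z) := by
  have hderiv := (hu.hasFDerivAt.restrictScalars ℝ).mul
    (hW.hasFDerivAt.comp z (hh.hasFDerivAt.restrictScalars ℝ))
  have hlin : ∀ w : ℂ, fderiv ℝ W (h z) w =
      w.re * fderiv ℝ W (h z) 1 + w.im * fderiv ℝ W (h z) I := fun w => by
    have hw : w = w.re • (1 : ℂ) + w.im • I := by simp [re_add_im]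
    conv_lhs => rw [hw, map_add, map_smul, map_smul, real_smul, real_smul]
  have hu_lin : fderiv ℂ u z I = I * fderiv ℂ u z 1 := by
    simp
  have hconj : conj a = a.re - a.im * I := by apply Complex.ext <;> simp
  have hderiv' : fderiv ℝ (fun ζ => u ζ * W (h ζ)) z = _ := hderiv.fderiv
  simp only [dbar, hderiv', add_apply, smul_apply,
    ContinuousLinearMap.comp_apply, ContinuousLinearMap.coe_restrictScalars',
    ContinuousLinearMap.toSpanSingleton_apply, smul_eq_mul, hu_lin, hconj, one_mul,
    Function.comp_apply]
  rw [hlin a, hlin (I * a)]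
  simp only [mul_re, mul_im, I_re, I_im]
  push_cast
  linear_combination (u z * (a.im * fderiv ℝ W (h z) 1)) * I_sq

theorem dbar_mul_conj (hp : DifferentiableAt ℂ p z) (hq : DifferentiableAt ℂ q z) :
    dbar (fun w => p w * conj (q w)) z = 2 * I * (p z * conj (deriv q z)) := by
  have hconj : dbar conj (q z) = 2 * I := by
    have : fderiv ℝ conj (q z) = conjCLE := conjCLE.hasFDerivAt.fderiv
    simp only [dbar, this, ContinuousLinearEquiv.coe_coe, conjCLE_apply, map_one, conj_I]
    ring
  rw [dbar_mul_comp (W := conj) hp hq.hasDerivAt conjCLE.differentiableAt, hconj]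
  ring

theorem integral_dbar_eq_zero (hW : ContDiff ℝ 1 W) (hs : HasCompactSupport W) :
    ∫ z, dbar W z = 0 := by
  have hinteg : ∀ v, Integrable (fun z => fderiv ℝ W z v) := fun v =>
    ((hW.continuous_fderiv one_ne_zero).clm_apply
      continuous_const).integrable_of_hasCompactSupport (hs.fderiv_apply ℝ v)
  have hzero : ∀ v, ∫ z, fderiv ℝ W z v = 0 := fun v => by
    simpa using integral_mul_fderiv_eq_neg_fderiv_mul_of_integrable (μ := volume) (𝕜 := ℂ)
      (f := fun _ => 1) (g := W) (v := v) (by simp) (by simpa using hinteg v)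
      (by simpa using hW.continuous.integrable_of_hasCompactSupport hs) (fun _ _ => by fun_prop)
      (fun z _ => hW.differentiable one_ne_zero z)
  simp only [dbar]
  rw [integral_sub ((hinteg 1).const_mul I) (hinteg I), integral_const_mul, hzero, hzero]
  simp

theorem integrable_dbar (hW : ContDiff ℝ 1 W) (hs : HasCompactSupport W) :
    Integrable (dbar W) := by
  refine Continuous.integrable_of_hasCompactSupport
    (continuous_iff_continuousAt.2 fun z => continuousAt_dbar hW.contDiffAt) ?_
  exact (hs.fderiv ℝ).comp_left (g := fun L : ℂ →L[ℝ] ℂ => I * L 1 - L I) (by simp)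

theorem abs_det_toSpanSingleton (a : ℂ) :
    |((ContinuousLinearMap.toSpanSingleton ℂ a).restrictScalars ℝ).det| = ‖a‖ ^ 2 := by
  have hdet : ((ContinuousLinearMap.toSpanSingleton ℂ a).restrictScalars ℝ).det =
      Algebra.norm ℝ (ContinuousLinearMap.toSpanSingleton ℂ a).det :=
    LinearMap.det_restrictScalars (R := ℝ)
      (f := (ContinuousLinearMap.toSpanSingleton ℂ a).toLinearMap)
  rw [hdet, ContinuousLinearMap.det_toSpanSingleton, Algebra.norm_complex_apply,
    abs_of_nonneg (normSq_nonneg a), normSq_eq_norm_sq]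

section ChangeOfVariables

variable {s : Set ℂ} {h' : ℂ → ℂ}

theorem integral_image_of_hasDerivAt (hs : MeasurableSet s)
    (hh : ∀ z ∈ s, HasDerivAt h (h' z) z) (hinj : InjOn h s) (F : ℂ → ℂ) :
    ∫ w in h '' s, F w = ∫ z in s, (‖h' z‖ : ℂ) ^ 2 * F (h z) := by
  rw [integral_image_eq_integral_abs_det_fderiv_smul volume hs
    (fun z hz => ((hh z hz).hasFDerivAt.restrictScalars ℝ).hasFDerivWithinAt) hinj]
  simp only [abs_det_toSpanSingleton, real_smul, ofReal_pow]

theorem integrableOn_image_of_hasDerivAt (hs : MeasurableSet s)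
    (hh : ∀ z ∈ s, HasDerivAt h (h' z) z) (hinj : InjOn h s) (F : ℂ → ℂ) :
    IntegrableOn F (h '' s) ↔ IntegrableOn (fun z => (‖h' z‖ : ℂ) ^ 2 * F (h z)) s := by
  rw [integrableOn_image_iff_integrableOn_abs_det_fderiv_smul volume hs
    (fun z hz => ((hh z hz).hasFDerivAt.restrictScalars ℝ).hasFDerivWithinAt) hinj]
  simp only [abs_det_toSpanSingleton, real_smul, ofReal_pow]

end ChangeOfVariables

theorem isOpen_norm_gt (ρ : ℝ) : IsOpen {z : ℂ | ρ < ‖z‖} :=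
  isOpen_lt continuous_const continuous_norm

theorem measurableSet_norm_gt (ρ : ℝ) : MeasurableSet {z : ℂ | ρ < ‖z‖} :=
  (isOpen_norm_gt ρ).measurableSet

section Strip

variable {a b c d : ℝ}

theorem exp_image_strip (a b : ℝ) :
    cexp '' (Ioo a b ×ℂ Ioc (-π) π) = {z | Real.exp a < ‖z‖ ∧ ‖z‖ < Real.exp b} := by
  ext z
  constructor
  · rintro ⟨w, hw, rfl⟩
    simpa [norm_exp] using (mem_reProdIm.1 hw).1
  · rintro ⟨hza, hzb⟩
    have hz : 0 < ‖z‖ := (Real.exp_pos a).trans hza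
    refine ⟨log z, mem_reProdIm.2 ⟨⟨?_, ?_⟩, ?_⟩, exp_log (norm_pos_iff.1 hz)⟩
    · rwa [log_re, Real.lt_log_iff_exp_lt hz]
    · rwa [log_re, Real.log_lt_iff_lt_exp hz]
    · rw [log_im]
      exact arg_mem_Ioc z

theorem exp_injOn_strip (a b : ℝ) : InjOn cexp (Ioo a b ×ℂ Ioc (-π) π) := by
  intro z hz w hw h
  rw [mem_reProdIm] at hz hw
  rw [← log_exp hz.2.1 hz.2.2, ← log_exp hw.2.1 hw.2.2, h]

theorem integral_annulus_eq_integral_strip (a b : ℝ) (G : ℂ → ℂ) :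
    ∫ z in {z | Real.exp a < ‖z‖ ∧ ‖z‖ < Real.exp b}, G z =
      ∫ ζ in Ioo a b ×ℂ Ioc (-π) π, (‖cexp ζ‖ : ℂ) ^ 2 * G (cexp ζ) := by
  have hmeas : MeasurableSet (Ioo a b ×ℂ Ioc (-π) π) :=
    (measurable_re measurableSet_Ioo).inter (measurable_im measurableSet_Ioc)
  rw [← exp_image_strip, integral_image_of_hasDerivAt hmeas
    (fun z _ => Complex.hasDerivAt_exp z) (exp_injOn_strip a b)]

theorem integral_reProdIm_eq (hab : a ≤ b) (hcd : c ≤ d) {F : ℂ → ℂ}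
    (hF : IntegrableOn F (Icc a b ×ℂ Icc c d)) :
    ∫ z in Ioo a b ×ℂ Ioc c d, F z = ∫ x in a..b, ∫ y in c..d, F (x + y * I) := by
  have hpres := Complex.volume_preserving_equiv_real_prod.symm
  have hpre : ∀ s t : Set ℝ, Complex.measurableEquivRealProd.symm ⁻¹' (s ×ℂ t) = s ×ˢ t := by
    intro s t
    ext p
    simp [mem_reProdIm, measurableEquivRealProd]
  have hF' := (hpres.integrableOn_comp_preimage (MeasurableEquiv.measurableEmbedding _)).2 hF
  rw [hpre, Measure.volume_eq_prod] at hF'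
  rw [intervalIntegral.integral_of_le hab, integral_Ioc_eq_integral_Ioo,
    ← hpres.setIntegral_preimage_emb (MeasurableEquiv.measurableEmbedding _), hpre,
    Measure.volume_eq_prod,
    setIntegral_prod (F <| Complex.measurableEquivRealProd.symm ·)
      (hF'.mono_set (prod_mono Ioo_subset_Icc_self Ioc_subset_Icc_self))]
  refine setIntegral_congr_fun measurableSet_Ioo fun x _ => ?_
  rw [intervalIntegral.integral_of_le hcd]
  exact setIntegral_congr_fun measurableSet_Ioc fun y _ => congrArg F (mk_eq_add_mul_I x y)

theorem integral_dbar_rectangle (hab : a ≤ b) (hcd : c ≤ d) {F : ℂ → ℂ}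
    (hF : ∀ ζ ∈ Icc a b ×ℂ Icc c d, ContDiffAt ℝ 1 F ζ)
    (hper : ∀ x : ℝ, F (x + d * I) = F (x + c * I)) (hright : ∀ y : ℝ, F (b + y * I) = 0) :
    ∫ ζ in Ioo a b ×ℂ Ioc c d, dbar F ζ = -∫ y in c..d, I * F (a + y * I) := by
  have hinteg : IntegrableOn (dbar F) (Icc a b ×ℂ Icc c d) :=
    ContinuousOn.integrableOn_compact (isCompact_Icc.reProdIm isCompact_Icc)
      fun ζ hζ => (continuousAt_dbar (hF ζ hζ)).continuousWithinAt
  have hgreen := integral_boundary_rect_of_differentiableOn_real F ⟨a, c⟩ ⟨b, d⟩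
    (by
      rw [uIcc_of_le hab, uIcc_of_le hcd]
      exact fun ζ hζ => ((hF ζ hζ).differentiableAt one_ne_zero).differentiableWithinAt)
    (by rwa [uIcc_of_le hab, uIcc_of_le hcd])
  simp only [hper, hright, sub_self, intervalIntegral.integral_zero, zero_add, smul_eq_mul,
    mul_zero, zero_sub] at hgreen
  rw [integral_reProdIm_eq hab hcd hinteg, intervalIntegral.integral_const_mul]
  exact hgreen.symm

theorem circleIntegral_exp (a : ℝ) (V : ℂ → ℂ) :
    ∮ z in C(0, Real.exp a), V z =
      ∫ y in (-π)..π, I * (cexp (a + y * I) * V (cexp (a + y * I))) := by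
  have hper : Function.Periodic (fun y : ℝ => deriv (circleMap 0 (Real.exp a)) y •
      V (circleMap 0 (Real.exp a) y)) (2 * π) := fun y => by
    simp only [deriv_circleMap, periodic_circleMap 0 (Real.exp a) y]
  have hshift := hper.intervalIntegral_add_eq (-π) 0
  rw [show -π + 2 * π = π by ring, zero_add] at hshift
  rw [circleIntegral, ← hshift]
  refine intervalIntegral.integral_congr fun y _ => ?_
  have hexp : cexp (a + y * I) = circleMap 0 (Real.exp a) y := by simp [circleMap, exp_add]
  simp only [hexp, deriv_circleMap, smul_eq_mul]
  ring

end Strip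

theorem integral_dbar_norm_gt_eq_annulus {ρ S : ℝ} (hV : ∀ z, S ≤ ‖z‖ → V z = 0) :
    ∫ z in {z | ρ < ‖z‖}, dbar V z = ∫ z in {z | ρ < ‖z‖ ∧ ‖z‖ < S}, dbar V z := by
  refine setIntegral_eq_of_subset_of_ae_sdiff_eq_zero
    (measurableSet_norm_gt ρ).nullMeasurableSet (fun z hz => hz.1) ?_
  have hsphere : ∀ᵐ z : ℂ, z ∉ sphere (0 : ℂ) S :=
    measure_eq_zero_iff_ae_notMem.1 (Measure.addHaar_sphere volume 0 S)
  filter_upwards [hsphere] with z hzS hz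
  have hSz : S < ‖z‖ := lt_of_le_of_ne (not_lt.1 fun h => hz.2 ⟨hz.1, h⟩)
    fun h => hzS (mem_sphere_zero_iff_norm.2 h.symm)
  have hVz : V =ᶠ[𝓝 z] fun _ => 0 := by
    filter_upwards [(isOpen_norm_gt S).mem_nhds hSz] with w hw using hV w (le_of_lt hw)
  simp [dbar, hVz.fderiv_eq]

theorem integral_dbar_norm_gt {ρ S : ℝ} (hρ : 0 < ρ)
    (hV : ∀ z, ρ ≤ ‖z‖ → ContDiffAt ℝ 1 V z) (hV0 : ∀ z, S ≤ ‖z‖ → V z = 0) :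
    ∫ z in {z | ρ < ‖z‖}, dbar V z = -∮ z in C(0, ρ), V z := by
  obtain ⟨a, rfl⟩ : ∃ a, Real.exp a = ρ := ⟨Real.log ρ, Real.exp_log hρ⟩
  obtain ⟨b, hab, hSb⟩ : ∃ b, a ≤ b ∧ S ≤ Real.exp b :=
    ⟨max a S, le_max_left a S, by linarith [le_max_right a S, Real.add_one_le_exp (max a S)]⟩
  have hVb : ∀ z, Real.exp b ≤ ‖z‖ → V z = 0 := fun z hz => hV0 z (hSb.trans hz)
  have hnorm : ∀ ζ ∈ Icc a b ×ℂ Icc (-π) π, Real.exp a ≤ ‖cexp ζ‖ := fun ζ hζ => by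
    rw [norm_exp]
    exact Real.exp_le_exp.2 (mem_reProdIm.1 hζ).1.1
  have hdbar : ∀ ζ ∈ Icc a b ×ℂ Icc (-π) π,
      dbar (fun ζ => cexp ζ * V (cexp ζ)) ζ = (‖cexp ζ‖ : ℂ) ^ 2 * dbar V (cexp ζ) :=
    fun ζ hζ => by
      rw [dbar_mul_comp differentiableAt_exp (Complex.hasDerivAt_exp ζ)
        ((hV _ (hnorm ζ hζ)).differentiableAt one_ne_zero), mul_conj']
  have hmeas : MeasurableSet (Ioo a b ×ℂ Ioc (-π) π) :=
    (measurable_re measurableSet_Ioo).inter (measurable_im measurableSet_Ioc)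
  rw [integral_dbar_norm_gt_eq_annulus hVb, integral_annulus_eq_integral_strip,
    circleIntegral_exp, ← setIntegral_congr_fun hmeas fun ζ hζ => hdbar ζ
      (mem_reProdIm.2 (And.imp (fun h => Ioo_subset_Icc_self h) (fun h => Ioc_subset_Icc_self h)
        (mem_reProdIm.1 hζ)))]
  refine integral_dbar_rectangle hab (by linarith [Real.pi_pos])
    (F := fun ζ => cexp ζ * V (cexp ζ)) (fun ζ hζ => ?_) (fun x => ?_) fun y => ?_
  · have hexp : ContDiffAt ℝ 1 cexp ζ := Complex.contDiff_exp.contDiffAt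
    exact hexp.mul ((hV _ (hnorm ζ hζ)).comp ζ hexp)
  · have : cexp (x + π * I) = cexp (x + (-π : ℝ) * I) :=
      exp_eq_exp_iff_exists_int.2 ⟨1, by push_cast; ring⟩
    simp only [this]
  · simp only [hVb (cexp (b + y * I)) (by simp [norm_exp]), mul_zero]

end Green

/-! ### Power series and expansions at infinity -/

section PowerSeries

variable {c : ℕ → ℂ} {R : ℝ} {v : ℂ}

theorem exists_norm_coeff_le {t : ℝ} (ht : 0 < t) (h : Summable fun k => c k * (t : ℂ) ^ k) :
    ∃ M, ∀ k, ‖c k‖ ≤ M / t ^ k := by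
  obtain ⟨M, hM⟩ := h.tendsto_atTop_zero.norm.bddAbove_range
  refine ⟨M, fun k => (le_div_iff₀ (by positivity)).2 ?_⟩
  simpa [abs_of_pos ht] using hM ⟨k, rfl⟩

theorem summable_succ_mul_norm_mul_pow {s t : ℝ} (hs : 0 ≤ s) (hst : s < t)
    (h : Summable fun k => c k * (t : ℂ) ^ k) :
    Summable fun k : ℕ => ((k : ℝ) + 1) * ‖c (k + 1)‖ * s ^ k := by
  have ht : 0 < t := hs.trans_lt hst
  obtain ⟨M, hM⟩ := exists_norm_coeff_le ht h
  have hgeom : ‖s / t‖ < 1 := by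
    rw [Real.norm_of_nonneg (by positivity)]
    exact (div_lt_one ht).2 hst
  have hsum : Summable fun k : ℕ => ((k : ℝ) + 1) * (s / t) ^ k := by
    simpa using summable_choose_mul_geometric_of_norm_lt_one 1 hgeom
  refine Summable.of_nonneg_of_le (fun k => by positivity) (fun k => ?_) (hsum.mul_left (M / t))
  calc ((k : ℝ) + 1) * ‖c (k + 1)‖ * s ^ k ≤ (k + 1) * (M / t ^ (k + 1)) * s ^ k := by
        gcongr
        exact hM (k + 1)
    _ = M / t * ((k + 1) * (s / t) ^ k) := by
      rw [div_pow, pow_succ]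
      field_simp

theorem norm_natCast_add_one (k : ℕ) : ‖(k : ℂ) + 1‖ = k + 1 :=
  mod_cast Complex.norm_natCast (k + 1)

theorem summable_ofReal_pow (h : ∀ v : ℂ, ‖v‖ < R → Summable fun k => c k * v ^ k) {t : ℝ}
    (ht : 0 ≤ t) (htR : t < R) : Summable fun k => c k * (t : ℂ) ^ k :=
  h t (by rwa [norm_real, Real.norm_of_nonneg ht])

theorem summable_norm_deriv_powerSeries
    (h : ∀ v : ℂ, ‖v‖ < R → Summable fun k => c k * v ^ k) (hv : ‖v‖ < R) :
    Summable fun k : ℕ => ‖((k : ℂ) + 1) * c (k + 1) * v ^ k‖ := by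
  obtain ⟨t, hvt, htR⟩ := exists_between hv
  refine (summable_succ_mul_norm_mul_pow (norm_nonneg v) hvt
    (summable_ofReal_pow h ((norm_nonneg v).trans hvt.le) htR)).congr fun k => ?_
  rw [norm_mul, norm_mul, norm_pow, norm_natCast_add_one]

theorem hasDerivAt_powerSeries (h : ∀ v : ℂ, ‖v‖ < R → Summable fun k => c k * v ^ k)
    (hv : ‖v‖ < R) :
    HasDerivAt (fun v => ∑' k, c k * v ^ k) (∑' k : ℕ, ((k : ℂ) + 1) * c (k + 1) * v ^ k) v := by
  obtain ⟨s, hvs, hsR⟩ := exists_between hv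
  obtain ⟨t, hst, htR⟩ := exists_between hsR
  have hs : 0 < s := (norm_nonneg v).trans_lt hvs
  have htail : HasDerivAt (fun v => ∑' k, c (k + 1) * v ^ (k + 1))
      (∑' k : ℕ, ((k : ℂ) + 1) * c (k + 1) * v ^ k) v := by
    refine hasDerivAt_tsum_of_isPreconnected (t := ball 0 s) (y₀ := 0)
      (g' := fun (k : ℕ) v => ((k : ℂ) + 1) * c (k + 1) * v ^ k)
      (summable_succ_mul_norm_mul_pow hs.le hst (summable_ofReal_pow h (hs.trans hst).le htR))
      isOpen_ball (convex_ball _ _).isPreconnected (fun k w _ => ?_) (fun k w hw => ?_)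
      (mem_ball_self hs) (by simp) (by simpa using hvs)
    · have hpow := (hasDerivAt_pow (k + 1) w).const_mul (c (k + 1))
      rwa [Nat.cast_succ, Nat.add_sub_cancel, ← mul_assoc, mul_comm (c (k + 1))] at hpow
    · rw [norm_mul, norm_mul, norm_pow, norm_natCast_add_one]
      have : ‖w‖ ≤ s := (mem_ball_zero_iff.1 hw).le
      gcongr
  refine (htail.const_add (c 0)).congr_of_eventuallyEq ?_
  filter_upwards [isOpen_ball.mem_nhds (mem_ball_zero_iff.2 hv)] with w hw
  rw [(h w (mem_ball_zero_iff.1 hw)).tsum_eq_zero_add, pow_zero, mul_one]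

theorem differentiableOn_powerSeries (h : ∀ v : ℂ, ‖v‖ < R → Summable fun k => c k * v ^ k) :
    DifferentiableOn ℂ (fun v => ∑' k, c k * v ^ k) (ball 0 R) := fun _ hv =>
  (hasDerivAt_powerSeries h (mem_ball_zero_iff.1 hv)).differentiableAt.differentiableWithinAt

theorem summable_powerSeries_shift (h : Summable fun k => c k * v ^ k) (i : ℕ) :
    Summable fun j => c (i + j) * v ^ j := by
  rcases eq_or_ne v 0 with rfl | hv
  · exact summable_of_ne_finset_zero (s := {0}) fun k hk => by
      rw [zero_pow (by simpa using hk), mul_zero]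
  · refine (((summable_nat_add_iff i).2 h).mul_left (v ^ i)⁻¹).congr fun j => ?_
    rw [add_comm j i, pow_add]
    field_simp

theorem hasSum_taylor_ball {h : ℂ → ℂ} (hh : DifferentiableOn ℂ h (ball 0 R)) (hv : ‖v‖ < R) :
    HasSum (fun n : ℕ => iteratedDeriv n h 0 / n.factorial * v ^ n) (h v) := by
  refine (Complex.hasSum_taylorSeries_on_ball hh (mem_ball_zero_iff.2 hv)).congr_fun fun n => ?_
  simp only [sub_zero, smul_eq_mul]
  ring

end PowerSeries

section ExpansionAtInfinity

variable {g : ℂ → ℂ} {r : ℂ} {c : ℕ → ℂ} {z : ℂ} {ρ : ℝ}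

/-- `g z = r z + c₀ + c₁ / z + c₂ / z ^ 2 + ⋯` on `{|z| > 1}`, with `r ≠ 0`. -/
structure HasExpansionAtInfinity (g : ℂ → ℂ) (r : ℂ) (c : ℕ → ℂ) : Prop where
  hasSum : ∀ z : ℂ, 1 < ‖z‖ → HasSum (fun k : ℕ => c k * z⁻¹ ^ k) (g z - r * z)
  ne_zero : r ≠ 0

theorem ne_zero_of_one_lt_norm (hz : 1 < ‖z‖) : z ≠ 0 := norm_pos_iff.1 (one_pos.trans hz)

theorem norm_inv_lt_one (hz : 1 < ‖z‖) : ‖z⁻¹‖ < 1 := by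
  rw [norm_inv]
  exact inv_lt_one_of_one_lt₀ hz

theorem one_lt_norm_inv (hz : ‖z‖ < 1) (hz0 : z ≠ 0) : 1 < ‖z⁻¹‖ := by
  rw [norm_inv]
  exact (one_lt_inv₀ (norm_pos_iff.2 hz0)).2 hz

namespace HasExpansionAtInfinity

theorem summable (hg : HasExpansionAtInfinity g r c) (v : ℂ) (hv : ‖v‖ < 1) :
    Summable fun k => c k * v ^ k := by
  rcases eq_or_ne v 0 with rfl | hv0
  · exact (summable_nat_add_iff 1).1 (by simp)
  · simpa using (hg.hasSum v⁻¹ (one_lt_norm_inv hv hv0)).summable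

theorem eq_add_tsum (hg : HasExpansionAtInfinity g r c) (hz : 1 < ‖z‖) :
    g z = r * z + ∑' k, c k * z⁻¹ ^ k := by
  rw [(hg.hasSum z hz).tsum_eq, add_sub_cancel]

theorem differentiableOn (hg : HasExpansionAtInfinity g r c) :
    DifferentiableOn ℂ g {z | 1 < ‖z‖} := by
  have hinv : DifferentiableOn ℂ (fun z : ℂ => z⁻¹) {z | 1 < ‖z‖} :=
    differentiableOn_id.inv fun z hz => ne_zero_of_one_lt_norm hz
  refine ((differentiableOn_id.const_mul r).add
    ((differentiableOn_powerSeries hg.summable).comp hinv fun z hz =>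
      mem_ball_zero_iff.2 (norm_inv_lt_one hz))).congr fun z hz => hg.eq_add_tsum hz

theorem hasDerivAt (hg : HasExpansionAtInfinity g r c) (hz : 1 < ‖z‖) :
    HasDerivAt g (deriv g z) z :=
  (hg.differentiableOn.differentiableAt ((isOpen_norm_gt 1).mem_nhds hz)).hasDerivAt

theorem inv_eq (hg : HasExpansionAtInfinity g r c) (hz : 1 < ‖z‖) :
    (g z)⁻¹ = z⁻¹ / (r + z⁻¹ * ∑' k, c k * z⁻¹ ^ k) := by
  have := ne_zero_of_one_lt_norm hz
  rw [hg.eq_add_tsum hz, ← inv_inj, inv_inv, inv_div]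
  field_simp

/-- `1 / g (1 / v)` extends holomorphically to `v = 0`; this is how the behaviour of `g` at
infinity is read off. -/
theorem hasStrictDerivAt_inv (hg : HasExpansionAtInfinity g r c) :
    HasStrictDerivAt (fun v => v / (r + v * ∑' k, c k * v ^ k)) r⁻¹ 0 := by
  have hG : AnalyticAt ℂ (fun v => ∑' k, c k * v ^ k) 0 :=
    (differentiableOn_powerSeries hg.summable).analyticAt (ball_mem_nhds 0 one_pos)
  have hden : AnalyticAt ℂ (fun v => r + v * ∑' k, c k * v ^ k) 0 :=
    analyticAt_const.add (analyticAt_id.mul hG)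
  have hr : r + 0 * ∑' k, c k * (0 : ℂ) ^ k ≠ 0 := by simpa using hg.ne_zero
  have hdiv := (hasStrictDerivAt_id (0 : ℂ)).div hden.hasStrictDerivAt hr
  simp only [id, zero_mul, add_zero, sub_zero, one_mul, sq, div_self_mul_self'] at hdiv
  exact hdiv

theorem tendsto_cobounded (hg : HasExpansionAtInfinity g r c) :
    Tendsto g (Bornology.cobounded ℂ) (Bornology.cobounded ℂ) := by
  have hinv := hg.hasStrictDerivAt_inv.hasDerivAt.tendsto_nhdsNE (inv_ne_zero hg.ne_zero)
  simp only [zero_div] at hinv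
  refine (tendsto_inv₀_nhdsNE_zero.comp (hinv.comp tendsto_inv₀_cobounded')).congr' ?_
  filter_upwards [tendsto_norm_cobounded_atTop.eventually_gt_atTop 1] with z hz
  rw [Function.comp_apply, Function.comp_apply, ← hg.inv_eq hz, inv_inv]

theorem image_norm_gt_mem_cobounded (hg : HasExpansionAtInfinity g r c) (hρ : 1 ≤ ρ) :
    g '' {z | ρ < ‖z‖} ∈ Bornology.cobounded ℂ := by
  have hball : (fun v => v / (r + v * ∑' k, c k * v ^ k)) '' ball 0 ρ⁻¹ ∈ 𝓝 (0 : ℂ) := by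
    have := image_mem_map (m := fun v => v / (r + v * ∑' k, c k * v ^ k))
      (ball_mem_nhds (0 : ℂ) (inv_pos.2 (one_pos.trans_le hρ)))
    rwa [hg.hasStrictDerivAt_inv.map_nhds_eq (inv_ne_zero hg.ne_zero), zero_div] at this
  filter_upwards [tendsto_inv₀_cobounded hball, Bornology.eventually_ne_cobounded 0]
    with w ⟨v, hv, hvw⟩ hw
  have hv0 : v ≠ 0 := by
    rintro rfl
    exact hw (inv_eq_zero.1 (by simpa using hvw.symm))
  have hρv : ρ < ‖v⁻¹‖ := by
    rw [norm_inv]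
    exact lt_inv_of_lt_inv₀ (norm_pos_iff.2 hv0) (mem_ball_zero_iff.1 hv)
  refine ⟨v⁻¹, hρv, inv_injective ?_⟩
  rw [hg.inv_eq (hρ.trans_lt hρv), inv_inv]
  exact hvw

end HasExpansionAtInfinity

/-- A univalent function on `{|z| > 1}` with a simple pole at infinity. -/
structure IsUnivalentAtInfinity (g : ℂ → ℂ) (r : ℂ) (c : ℕ → ℂ) : Prop
    extends HasExpansionAtInfinity g r c where
  injOn : InjOn g {z | 1 < ‖z‖}

/-- The compact set enclosed by the curve `g {|z| = ρ}`, when `g` is univalent at infinity. -/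
def enclosedSet (g : ℂ → ℂ) (ρ : ℝ) : Set ℂ := (g '' {z | ρ < ‖z‖})ᶜ

theorem HasExpansionAtInfinity.isBounded_enclosedSet (hg : HasExpansionAtInfinity g r c)
    (hρ : 1 ≤ ρ) : Bornology.IsBounded (enclosedSet g ρ) :=
  Bornology.isBounded_def.2 (by simpa [enclosedSet] using hg.image_norm_gt_mem_cobounded hρ)

theorem exists_contDiff_hasCompactSupport_eventuallyEq {φ : ℂ → ℂ} (hφ : ContDiff ℝ 1 φ) {R : ℝ}
    (hR : 0 < R) : ∃ W : ℂ → ℂ, ContDiff ℝ 1 W ∧ HasCompactSupport W ∧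
      ∀ w, ‖w‖ < R → W =ᶠ[𝓝 w] φ := by
  let χ : ContDiffBump (0 : ℂ) := ⟨R, R + 1, hR, by linarith⟩
  refine ⟨fun w => χ w * φ w, (ofRealCLM.contDiff.comp χ.contDiff).mul hφ,
    (χ.hasCompactSupport.comp_left (g := fun x : ℝ => (x : ℂ)) ofReal_zero).mul_right,
    fun w hw => ?_⟩
  filter_upwards [isOpen_ball.mem_nhds (mem_ball_zero_iff.2 hw)] with x hx
  simp [χ.one_of_mem_closedBall (ball_subset_closedBall hx)]

namespace IsUnivalentAtInfinity

theorem measurableSet_enclosedSet (hg : IsUnivalentAtInfinity g r c) (hρ : 1 ≤ ρ) :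
    MeasurableSet (enclosedSet g ρ) :=
  (measurable_image_of_fderivWithin (measurableSet_norm_gt ρ)
    (fun _ hz => ((hg.hasDerivAt (hρ.trans_lt hz)).hasFDerivAt.restrictScalars
      ℝ).hasFDerivWithinAt) (hg.injOn.mono fun _ hz => hρ.trans_lt hz)).compl

theorem integral_dbar_image (hg : IsUnivalentAtInfinity g r c) (hρ : 1 < ρ) {W : ℂ → ℂ}
    (hW : ContDiff ℝ 1 W) (hWs : HasCompactSupport W) :
    ∫ w in g '' {z | ρ < ‖z‖}, dbar W w = -∮ z in C(0, ρ), deriv g z * W (g z) := by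
  have hderiv : DifferentiableOn ℂ (deriv g) {z | 1 < ‖z‖} :=
    hg.differentiableOn.deriv (isOpen_norm_gt 1)
  have hsmooth : ∀ {f : ℂ → ℂ}, DifferentiableOn ℂ f {z | 1 < ‖z‖} → ∀ z, 1 < ‖z‖ →
      ContDiffAt ℝ 1 f z := fun hf z hz =>
    ((hf.contDiffOn (isOpen_norm_gt 1)).contDiffAt
      ((isOpen_norm_gt 1).mem_nhds hz)).restrict_scalars ℝ
  have hdbar : ∀ z, ρ < ‖z‖ →
      dbar (fun z => deriv g z * W (g z)) z = (‖deriv g z‖ : ℂ) ^ 2 * dbar W (g z) :=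
    fun z hz => by
      rw [dbar_mul_comp (hderiv.differentiableAt ((isOpen_norm_gt 1).mem_nhds (hρ.trans hz)))
        (hg.hasDerivAt (hρ.trans hz)) (hW.differentiable one_ne_zero _), mul_conj']
  have hfar : ∀ᶠ z in Bornology.cobounded ℂ, W (g z) = 0 := by
    refine hg.tendsto_cobounded.eventually (p := fun w => W w = 0) ?_
    rw [Metric.cobounded_eq_cocompact]
    exact mem_cocompact.2 ⟨_, hWs.isCompact, fun w hw => image_eq_zero_of_notMem_tsupport hw⟩
  obtain ⟨S, -, hS⟩ := (hasBasis_cobounded_norm (E := ℂ)).eventually_iff.1 hfar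
  rw [integral_image_of_hasDerivAt (measurableSet_norm_gt ρ)
      (fun z hz => hg.hasDerivAt (hρ.trans hz)) (hg.injOn.mono fun z hz => hρ.trans hz),
    ← setIntegral_congr_fun (measurableSet_norm_gt ρ) hdbar]
  refine integral_dbar_norm_gt (S := S) (one_pos.trans hρ) (fun z hz => ?_) fun z hz => ?_
  · have hz' : 1 < ‖z‖ := hρ.trans_le hz
    exact (hsmooth hderiv z hz').mul (hW.contDiffAt.comp z (hsmooth hg.differentiableOn z hz'))
  · rw [hS hz, mul_zero]

theorem integral_dbar_enclosedSet (hg : IsUnivalentAtInfinity g r c) (hρ : 1 < ρ) {φ : ℂ → ℂ}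
    (hφ : ContDiff ℝ 1 φ) :
    ∫ w in enclosedSet g ρ, dbar φ w = ∮ z in C(0, ρ), deriv g z * φ (g z) := by
  have hsphere : ContinuousOn g (sphere 0 ρ) := hg.differentiableOn.continuousOn.mono fun z hz => by
    simpa [mem_sphere_zero_iff_norm.1 hz] using hρ
  obtain ⟨R, hR, hRsub⟩ := ((hg.isBounded_enclosedSet hρ.le).union
    ((isCompact_sphere (0 : ℂ) ρ).image_of_continuousOn hsphere).isBounded).subset_ball_lt 0 0
  obtain ⟨W, hW, hWs, hWφ⟩ := exists_contDiff_hasCompactSupport_eventuallyEq hφ hR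
  have hzero := integral_dbar_eq_zero hW hWs
  rw [← integral_add_compl (hg.measurableSet_enclosedSet hρ.le) (integrable_dbar hW hWs),
    enclosedSet, compl_compl, hg.integral_dbar_image hρ hW hWs, add_neg_eq_zero] at hzero
  calc ∫ w in enclosedSet g ρ, dbar φ w = ∫ w in enclosedSet g ρ, dbar W w :=
        setIntegral_congr_fun (hg.measurableSet_enclosedSet hρ.le) fun w hw =>
          (dbar_congr (hWφ w (mem_ball_zero_iff.1 (hRsub (Or.inl hw))))).symm
    _ = ∮ z in C(0, ρ), deriv g z * W (g z) := hzero
    _ = ∮ z in C(0, ρ), deriv g z * φ (g z) :=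
        circleIntegral.integral_congr (one_pos.trans hρ).le fun z hz => by
          simp only [(hWφ _ (mem_ball_zero_iff.1
            (hRsub (Or.inr (mem_image_of_mem g hz))))).eq_of_nhds]

theorem integral_enclosedSet_mul_conj_deriv (hg : IsUnivalentAtInfinity g r c) (hρ : 1 < ρ)
    {p q : ℂ → ℂ} (hp : Differentiable ℂ p) (hq : Differentiable ℂ q) :
    2 * I * ∫ w in enclosedSet g ρ, p w * conj (deriv q w) =
      ∮ z in C(0, ρ), deriv g z * (p (g z) * conj (q (g z))) := by
  rw [← hg.integral_dbar_enclosedSet hρ (φ := fun w => p w * conj (q w)), ← integral_const_mul]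
  · simp only [dbar_mul_conj (hp _) (hq _)]
  · exact hp.contDiff.restrict_scalars ℝ |>.mul
      (conjCLE.contDiff.comp (hq.contDiff.restrict_scalars ℝ))

end IsUnivalentAtInfinity

end ExpansionAtInfinity

/-! ### Parseval's identity -/

section Parseval

open Real (circleAverage)

theorem hasSum_circleAverage {ι : Type*} [Countable ι] {F : ι → ℂ → ℂ} {f : ℂ → ℂ} {b : ι → ℝ}
    {a : ℂ} {ρ : ℝ} (hρ : 0 ≤ ρ) (hF : ∀ i, ContinuousOn (F i) (sphere a ρ)) (hb : Summable b)
    (hFb : ∀ i, ∀ z ∈ sphere a ρ, ‖F i z‖ ≤ b i)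
    (hf : ∀ z ∈ sphere a ρ, HasSum (F · z) (f z)) :
    HasSum (fun i => circleAverage (F i) a ρ) (circleAverage f a ρ) := by
  refine HasSum.const_smul (2 * π)⁻¹ (intervalIntegral.hasSum_integral_of_dominated_convergence
    (fun i _ => b i) (fun i => ?_)
    (fun i => Eventually.of_forall fun θ _ => hFb i _ (circleMap_mem_sphere a hρ θ))
    (Eventually.of_forall fun _ _ => hb) intervalIntegrable_const
    (Eventually.of_forall fun θ _ => hf _ (circleMap_mem_sphere a hρ θ)))
  exact ((hF i).comp_continuous (continuous_circleMap a ρ)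
    (circleMap_mem_sphere a hρ)).aestronglyMeasurable

theorem circleAverage_zpow_mul_conj_zpow {ρ : ℝ} (hρ : 0 < ρ) (m n : ℤ) :
    circleAverage (fun z => z ^ m * conj (z ^ n)) 0 ρ = if m = n then (ρ : ℂ) ^ (2 * n) else 0 := by
  have hsphere : EqOn (fun z : ℂ => (z - 0)⁻¹ • (z ^ m * conj (z ^ n)))
      (fun z => (ρ : ℂ) ^ (2 * n) * (z - 0) ^ (m - n - 1)) (sphere 0 ρ) := fun z hz => by
    have hz0 : z ≠ 0 := ne_of_mem_sphere hz hρ.ne'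
    have hconj : conj z = ρ ^ 2 / z := by
      rw [eq_div_iff hz0, mul_comm, mul_conj', mem_sphere_zero_iff_norm.1 hz]
    simp only [sub_zero, smul_eq_mul]
    rw [map_zpow₀, hconj, div_zpow, zpow_sub₀ hz0, zpow_sub₀ hz0, zpow_one, zpow_mul]
    norm_cast
    ring
  rw [Real.circleAverage_eq_circleIntegral hρ.ne', circleIntegral.integral_congr hρ.le hsphere,
    circleIntegral.integral_const_mul]
  split_ifs with hmn
  · subst hmn
    rw [sub_self, zero_sub]
    simp only [zpow_neg_one, circleIntegral.integral_sub_center_inv 0 hρ.ne', smul_eq_mul]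
    field_simp
  · rw [circleIntegral.integral_sub_zpow_of_ne (by omega), mul_zero, smul_zero]

theorem hasSum_prod_circleAverage_mul_conj {p q : ℤ → ℂ} {P Q : ℂ → ℂ} {ρ : ℝ}
    (hρ : 0 < ρ)
    (hP : ∀ z ∈ sphere (0 : ℂ) ρ, HasSum (fun n => p n * z ^ n) (P z))
    (hQ : ∀ z ∈ sphere (0 : ℂ) ρ, HasSum (fun n => q n * z ^ n) (Q z)) :
    HasSum (fun x : ℤ × ℤ => circleAverage (fun z => p x.1 * z ^ x.1 * conj (q x.2 * z ^ x.2)) 0 ρ)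
      (circleAverage (fun z => P z * conj (Q z)) 0 ρ) := by
  have hρmem : (ρ : ℂ) ∈ sphere (0 : ℂ) ρ := by simp [abs_of_pos hρ]
  have hterm : ∀ (s : ℤ → ℂ) (n : ℤ), ContinuousOn (fun z => s n * z ^ n) (sphere 0 ρ) :=
    fun s n z hz => (continuousAt_const.mul
      (continuousAt_zpow₀ z n (Or.inl (ne_of_mem_sphere hz hρ.ne')))).continuousWithinAt
  have hnorm : ∀ x : ℤ × ℤ, ∀ z ∈ sphere (0 : ℂ) ρ,
      ‖p x.1 * z ^ x.1 * conj (q x.2 * z ^ x.2)‖ =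
        ‖p x.1 * (ρ : ℂ) ^ x.1‖ * ‖q x.2 * (ρ : ℂ) ^ x.2‖ := fun x z hz => by
    simp [mem_sphere_zero_iff_norm.1 hz, abs_of_pos hρ]
  have hbound : Summable fun x : ℤ × ℤ =>
      ‖p x.1 * (ρ : ℂ) ^ x.1‖ * ‖q x.2 * (ρ : ℂ) ^ x.2‖ :=
    (hP ρ hρmem).summable.norm.mul_of_nonneg (hQ ρ hρmem).summable.norm
      (fun _ => norm_nonneg _) fun _ => norm_nonneg _
  have hprod : ∀ z ∈ sphere (0 : ℂ) ρ,
      HasSum (fun x : ℤ × ℤ => p x.1 * z ^ x.1 * conj (q x.2 * z ^ x.2)) (P z * conj (Q z)) :=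
    fun z hz => by
      have hconj : HasSum (fun n => conj (q n * z ^ n)) (conj (Q z)) := hasSum_conj'.2 (hQ z hz)
      have hsummable : Summable fun x : ℤ × ℤ => p x.1 * z ^ x.1 * conj (q x.2 * z ^ x.2) :=
        Summable.of_norm (by simpa only [hnorm _ z hz] using hbound)
      exact ((hP z hz).mul hconj hsummable :)
  have hcont : ∀ x : ℤ × ℤ, ContinuousOn
      (fun z : ℂ => p x.1 * z ^ x.1 * conj (q x.2 * z ^ x.2)) (sphere 0 ρ) := fun x =>
    (hterm p x.1).mul (continuous_conj.comp_continuousOn (hterm q x.2))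
  exact hasSum_circleAverage hρ.le hcont hbound (fun x z hz => (hnorm x z hz).le) hprod

theorem hasSum_circleAverage_mul_conj {p q : ℤ → ℂ} {P Q : ℂ → ℂ} {ρ : ℝ} (hρ : 0 < ρ)
    (hP : ∀ z ∈ sphere (0 : ℂ) ρ, HasSum (fun n => p n * z ^ n) (P z))
    (hQ : ∀ z ∈ sphere (0 : ℂ) ρ, HasSum (fun n => q n * z ^ n) (Q z)) :
    HasSum (fun n => p n * conj (q n) * (ρ : ℂ) ^ (2 * n))
      (circleAverage (fun z => P z * conj (Q z)) 0 ρ) := by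
  have hdouble := hasSum_prod_circleAverage_mul_conj hρ hP hQ
  have hsmul : ∀ (x : ℤ × ℤ) (z : ℂ), p x.1 * z ^ x.1 * conj (q x.2 * z ^ x.2) =
      (p x.1 * conj (q x.2)) • (z ^ x.1 * conj (z ^ x.2)) := fun x z => by
    rw [map_mul, smul_eq_mul]
    ring
  simp only [hsmul, Real.circleAverage_fun_smul, circleAverage_zpow_mul_conj_zpow hρ] at hdouble
  have hdiag : Function.Injective fun n : ℤ => (n, n) := fun _ _ h => (Prod.mk.inj h).1
  rw [← hdiag.hasSum_iff] at hdouble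
  · simpa [Function.comp_def] using hdouble
  · rintro ⟨m, n⟩ hmn
    rw [if_neg fun h : m = n => hmn ⟨m, by rw [h]⟩, smul_zero]

end Parseval

/-! ### Faber polynomials -/

section Faber

open scoped PowerSeries

/-- The Faber polynomials of `g z = r z + c₀ + c₁ / z + ⋯`: the `m`-th one is the polynomial `F` of
degree `m` for which `F (g z) - z ^ m` vanishes at infinity. -/
noncomputable def faber (r : ℂ) (c : ℕ → ℂ) : ℕ → Polynomial ℂ
  | 0 => 1
  | k + 1 => .C r⁻¹ * (.X * faber r c k - ∑ j : Fin (k + 1), .C (c j) * faber r c (k - j)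
      - .C (k * c k))

/-- The power series `u (g (1 / u) - w) / r` in `u`, where `g z = r z + c₀ + c₁ / z + ⋯`. -/
noncomputable def differenceSeries (r : ℂ) (c : ℕ → ℂ) (w : ℂ) : ℂ⟦X⟧ :=
  .mk fun
    | 0 => 1
    | k + 1 => (c k - if k = 0 then w else 0) / r

/-- The power series `(g (1 / u) - g (1 / v)) / (r (1 / u - 1 / v))` in `u`, where
`g z = r z + c₀ + c₁ / z + ⋯`. -/
noncomputable def kernelSeries (r : ℂ) (c : ℕ → ℂ) (v : ℂ) : ℂ⟦X⟧ :=
  .mk fun i => if i = 0 then 1 else -(v / r * ∑' j, c (i + j) * v ^ j)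

/-- The part of negative degree of `faber r c m ∘ g`, as a function of `v = 1 / z`: a coefficient of
the logarithmic derivative in `u` of the kernel series. -/
noncomputable def faberTail (r : ℂ) (c : ℕ → ℂ) (m : ℕ) (v : ℂ) : ℂ :=
  PowerSeries.coeff m
    (-(PowerSeries.X * d⁄dX ℂ (kernelSeries r c v)) * (kernelSeries r c v)⁻¹)

variable {g : ℂ → ℂ} {r : ℂ} {c : ℕ → ℂ} {z v w : ℂ}

theorem faber_succ (k : ℕ) :
    faber r c (k + 1) = .C r⁻¹ * (.X * faber r c k
      - ∑ j ∈ Finset.range (k + 1), .C (c j) * faber r c (k - j) - .C (k * c k)) := by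
  rw [faber, Finset.sum_range]

theorem natDegree_faber_le (m : ℕ) : (faber r c m).natDegree ≤ m := by
  induction m using Nat.strong_induction_on with
  | _ m ih =>
    rcases m with _ | k
    · simp [faber]
    rw [faber_succ]
    have hX : (.X * faber r c k : Polynomial ℂ).natDegree ≤ k + 1 := by
      have := ih k k.lt_succ_self
      exact Polynomial.natDegree_mul_le_of_le Polynomial.natDegree_X_le this |>.trans (by omega)
    have hsum : (∑ j ∈ Finset.range (k + 1), .C (c j) * faber r c (k - j) :
        Polynomial ℂ).natDegree ≤ k + 1 :=
      Polynomial.natDegree_sum_le_of_forall_le _ _ fun j _ =>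
        (Polynomial.natDegree_C_mul_le _ _).trans ((ih _ (by omega)).trans (by omega))
    refine (Polynomial.natDegree_C_mul_le _ _).trans ?_
    simpa using Polynomial.natDegree_sub_le_of_le (Polynomial.natDegree_sub_le_of_le hX hsum)
      (Polynomial.natDegree_C (k * c k)).le

theorem coeff_faber_self (m : ℕ) : (faber r c m).coeff m = r⁻¹ ^ m := by
  induction m with
  | zero => simp [faber]
  | succ k ih =>
    have hlower : ∀ j ∈ Finset.range (k + 1),
        (.C (c j) * faber r c (k - j) : Polynomial ℂ).coeff (k + 1) = 0 := fun j _ => by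
      rw [Polynomial.coeff_C_mul, Polynomial.coeff_eq_zero_of_natDegree_lt, mul_zero]
      exact (natDegree_faber_le _).trans_lt (by omega)
    rw [faber_succ, Polynomial.coeff_C_mul, Polynomial.coeff_sub, Polynomial.coeff_sub,
      Polynomial.coeff_X_mul, ih, Polynomial.finsetSum_coeff, Finset.sum_eq_zero hlower,
      Polynomial.coeff_C_succ, sub_zero, sub_zero, pow_succ']

/-- The recursion of the Faber polynomials says that `∑ Fₘ(w) uᵐ = 1 - u Y'(u) / Y(u)`, where
`Y(u) = u (g (1 / u) - w) / r`. -/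
theorem differenceSeries_mul_mk_eval_faber :
    differenceSeries r c w * .mk (fun i => (faber r c i).eval w) =
      differenceSeries r c w - PowerSeries.X * d⁄dX ℂ (differenceSeries r c w) := by
  ext k
  rcases k with _ | k
  · simp [differenceSeries, faber]
  have hsum : ∑ j ∈ Finset.range (k + 1),
      (c j - if j = 0 then w else 0) / r * (faber r c (k - j)).eval w =
        r⁻¹ * (∑ j ∈ Finset.range (k + 1), c j * (faber r c (k - j)).eval w
          - w * (faber r c k).eval w) := by
    simp only [div_eq_inv_mul, mul_assoc, ← Finset.mul_sum, sub_mul, ite_mul, zero_mul,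
      Finset.sum_sub_distrib, Finset.sum_ite_eq', Finset.mem_range, Nat.succ_pos, if_true,
      Nat.sub_zero]
  rw [PowerSeries.coeff_mul, Finset.Nat.sum_antidiagonal_eq_sum_range_succ_mk,
    Finset.sum_range_succ', map_sub, PowerSeries.coeff_succ_X_mul, PowerSeries.coeff_derivative]
  simp only [differenceSeries, PowerSeries.coeff_mk, Nat.add_sub_add_right, hsum, faber_succ,
    Polynomial.eval_mul, Polynomial.eval_sub, Polynomial.eval_C, Polynomial.eval_X,
    Polynomial.eval_finsetSum, Nat.sub_zero]
  split_ifs with hk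
  · subst hk
    simp
    ring
  · ring

theorem constantCoeff_kernelSeries : PowerSeries.constantCoeff (kernelSeries r c v) = 1 := by
  simp [kernelSeries]

theorem kernelSeries_mul_mk_faberTail :
    kernelSeries r c v * .mk (fun m => faberTail r c m v) =
      -(PowerSeries.X * d⁄dX ℂ (kernelSeries r c v)) := by
  have hmk : (.mk fun m => faberTail r c m v) =
      -(PowerSeries.X * d⁄dX ℂ (kernelSeries r c v)) * (kernelSeries r c v)⁻¹ :=
    PowerSeries.ext fun m => PowerSeries.coeff_mk m _
  rw [hmk, mul_left_comm, PowerSeries.mul_inv_cancel _ (by simp [constantCoeff_kernelSeries]),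
    mul_one]

theorem faberTail_eq_sub_sum (m : ℕ) (v : ℂ) :
    faberTail r c m v = -(m * PowerSeries.coeff m (kernelSeries r c v)) -
      ∑ i ∈ Finset.range m, faberTail r c i v *
        PowerSeries.coeff (m - i) (kernelSeries r c v) := by
  have hcoeff := congrArg (PowerSeries.coeff m) (kernelSeries_mul_mk_faberTail (r := r) (c := c)
    (v := v))
  have hderiv : PowerSeries.coeff m (PowerSeries.X * d⁄dX ℂ (kernelSeries r c v)) =
      m * PowerSeries.coeff m (kernelSeries r c v) := by
    rcases m with _ | m
    · simp
    · rw [PowerSeries.coeff_succ_X_mul, PowerSeries.coeff_derivative, mul_comm, Nat.cast_succ]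
  rw [mul_comm, PowerSeries.coeff_mul, Finset.Nat.sum_antidiagonal_eq_sum_range_succ_mk, map_neg,
    hderiv, Finset.sum_range_succ] at hcoeff
  simp only [PowerSeries.coeff_mk, Nat.sub_self, PowerSeries.coeff_zero_eq_constantCoeff_apply,
    constantCoeff_kernelSeries, mul_one] at hcoeff
  exact eq_sub_of_add_eq' hcoeff

theorem faberTail_apply_zero (m : ℕ) : faberTail r c m 0 = 0 := by
  have hone : kernelSeries r c 0 = 1 := by
    ext i
    simp [kernelSeries, PowerSeries.coeff_one]
  rw [faberTail, hone, PowerSeries.derivative_one, mul_zero, neg_zero, zero_mul, map_zero]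

namespace HasExpansionAtInfinity

theorem differentiableOn_coeff_kernelSeries (hg : HasExpansionAtInfinity g r c) (i : ℕ) :
    DifferentiableOn ℂ (fun v => PowerSeries.coeff i (kernelSeries r c v)) (ball 0 1) := by
  simp only [kernelSeries, PowerSeries.coeff_mk]
  split_ifs
  · exact differentiableOn_const 1
  · exact ((differentiableOn_id.div_const r).mul
      (differentiableOn_powerSeries fun v hv =>
        summable_powerSeries_shift (hg.summable v hv) i)).neg

theorem differentiableOn_faberTail (hg : HasExpansionAtInfinity g r c) (m : ℕ) :
    DifferentiableOn ℂ (faberTail r c m) (ball 0 1) := by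
  induction m using Nat.strong_induction_on with
  | _ m ih =>
    refine DifferentiableOn.congr (DifferentiableOn.sub ?_ (DifferentiableOn.fun_sum fun i hi =>
      (ih i (Finset.mem_range.1 hi)).mul (hg.differentiableOn_coeff_kernelSeries (m - i))))
      fun v _ => faberTail_eq_sub_sum m v
    exact ((hg.differentiableOn_coeff_kernelSeries m).const_mul _).neg

/-- Multiplying `(g (1 / u) - g z) / (r (1 / u - z))` by `1 - z u` clears the denominator. -/
theorem differenceSeries_eq_mul_kernelSeries (hg : HasExpansionAtInfinity g r c) (hz : 1 < ‖z‖) :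
    differenceSeries r c (g z) =
      (1 - PowerSeries.C z * PowerSeries.X) * kernelSeries r c z⁻¹ := by
  have hz0 := ne_zero_of_one_lt_norm hz
  have hr := hg.ne_zero
  have hshift : ∀ k, ∑' j, c (k + j) * z⁻¹ ^ j = c k + z⁻¹ * ∑' j, c (k + 1 + j) * z⁻¹ ^ j :=
    fun k => by
      rw [(summable_powerSeries_shift (hg.summable z⁻¹ (norm_inv_lt_one hz)) k).tsum_eq_zero_add,
        ← tsum_mul_left]
      simp only [add_zero, pow_zero, mul_one, pow_succ', add_assoc, add_comm 1, mul_left_comm]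
  ext i
  rw [sub_mul, one_mul, mul_assoc, map_sub, PowerSeries.coeff_C_mul]
  rcases i with _ | k
  · simp [differenceSeries, kernelSeries]
  rw [PowerSeries.coeff_succ_X_mul]
  simp only [differenceSeries, kernelSeries, PowerSeries.coeff_mk, Nat.succ_ne_zero, if_false]
  split_ifs with hk
  · subst hk
    have hseries := hshift 0
    simp only [zero_add] at hseries
    rw [hg.eq_add_tsum hz, hseries]
    field_simp
    ring
  · rw [hshift k]
    field_simp
    ring

theorem eval_faber (hg : HasExpansionAtInfinity g r c) (m : ℕ) (hz : 1 < ‖z‖) :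
    (faber r c m).eval (g z) = z ^ m + faberTail r c m z⁻¹ := by
  let E : ℂ⟦X⟧ := 1 - PowerSeries.C z * PowerSeries.X
  let Ψ := kernelSeries r c z⁻¹
  have hgeom : E * .mk (fun i => z ^ i) = 1 := by
    ext k
    rw [sub_mul, one_mul, mul_assoc, map_sub, PowerSeries.coeff_C_mul]
    rcases k with _ | k
    · simp
    · simp [PowerSeries.coeff_succ_X_mul, pow_succ', PowerSeries.coeff_one]
  have hE : d⁄dX ℂ E = -PowerSeries.C z := by simp [E, Derivation.leibniz]
  have hne : E * Ψ ≠ 0 := fun h => by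
    simpa [E, Ψ, constantCoeff_kernelSeries] using congrArg PowerSeries.constantCoeff h
  have hseries : (.mk fun i => (faber r c i).eval (g z) : ℂ⟦X⟧) =
      .mk (fun i => z ^ i) + .mk (fun m => faberTail r c m z⁻¹) := by
    refine mul_left_cancel₀ hne ?_
    calc E * Ψ * .mk (fun i => (faber r c i).eval (g z))
        = E * Ψ - PowerSeries.X * d⁄dX ℂ (E * Ψ) := by
          rw [← hg.differenceSeries_eq_mul_kernelSeries hz, differenceSeries_mul_mk_eval_faber]
      _ = Ψ + E * -(PowerSeries.X * d⁄dX ℂ Ψ) := by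
          rw [Derivation.leibniz, hE, smul_eq_mul, smul_eq_mul]
          ring
      _ = E * .mk (fun i => z ^ i) * Ψ + E * (Ψ * .mk (fun m => faberTail r c m z⁻¹)) := by
          rw [hgeom, one_mul, kernelSeries_mul_mk_faberTail]
      _ = E * Ψ * (.mk (fun i => z ^ i) + .mk (fun m => faberTail r c m z⁻¹)) := by ring
  simpa using congrArg (PowerSeries.coeff m) hseries

end HasExpansionAtInfinity

end Faber

/-! ### The Gram matrix of the Faber polynomials -/

section Gram

open Real (circleAverage)

variable {g : ℂ → ℂ} {r : ℂ} {c : ℕ → ℂ} {z : ℂ} {ρ : ℝ}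

/-- The coefficient of `z ^ (-(n + 1))` of `faber r c m ∘ g`. -/
noncomputable def faberCoeff (r : ℂ) (c : ℕ → ℂ) (m n : ℕ) : ℂ :=
  iteratedDeriv (n + 1) (faberTail r c m) 0 / (n + 1).factorial

/-- The Laurent coefficients at infinity of `faber r c m ∘ g`. -/
noncomputable def faberLaurentCoeff (r : ℂ) (c : ℕ → ℂ) (m : ℕ) : ℤ → ℂ
  | Int.ofNat n => if n = m then 1 else 0
  | Int.negSucc n => faberCoeff r c m n

/-- The inner product of the derivatives of the Faber polynomials on the compact set enclosed by
`g {|z| = ρ}`. -/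
noncomputable def faberGram (g : ℂ → ℂ) (r : ℂ) (c : ℕ → ℂ) (ρ : ℝ) (j k : ℕ) : ℂ :=
  ∫ w in enclosedSet g ρ,
    (faber r c j).derivative.eval w * conj ((faber r c k).derivative.eval w)

theorem hasSum_zpow_of_natCast_of_negSucc {p : ℤ → ℂ} {m : ℕ} {s : ℂ}
    (hpos : ∀ n : ℕ, n ≠ m → p n = 0)
    (hneg : HasSum (fun n : ℕ => p (Int.negSucc n) * z⁻¹ ^ (n + 1)) s) :
    HasSum (fun n => p n * z ^ n) (p m * z ^ m + s) := by
  have hnat : HasSum (fun n : ℕ => p n * z ^ n) (p m * z ^ m) :=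
    hasSum_single m fun n hn => by rw [hpos n hn, zero_mul]
  refine (hnat.int_rec hneg).congr_fun fun n => ?_
  cases n <;> simp

namespace HasExpansionAtInfinity

theorem hasSum_taylor_faberTail (hg : HasExpansionAtInfinity g r c) (m : ℕ) {v : ℂ}
    (hv : ‖v‖ < 1) :
    HasSum (fun n => iteratedDeriv n (faberTail r c m) 0 / n.factorial * v ^ n)
      (faberTail r c m v) :=
  hasSum_taylor_ball (hg.differentiableOn_faberTail m) hv

theorem hasSum_faberTail (hg : HasExpansionAtInfinity g r c) (m : ℕ) {v : ℂ} (hv : ‖v‖ < 1) :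
    HasSum (fun n => faberCoeff r c m n * v ^ (n + 1)) (faberTail r c m v) := by
  simpa [faberTail_apply_zero, faberCoeff] using
    (hasSum_nat_add_iff' 1).2 (hg.hasSum_taylor_faberTail m hv)

theorem hasSum_deriv_faberTail (hg : HasExpansionAtInfinity g r c) (m : ℕ) {v : ℂ}
    (hv : ‖v‖ < 1) :
    HasSum (fun n : ℕ => ((n : ℂ) + 1) * faberCoeff r c m n * v ^ (n + 1))
      (v * deriv (faberTail r c m) v) := by
  have hsummable := fun w (hw : ‖w‖ < 1) => (hg.hasSum_taylor_faberTail m hw).summable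
  have heq : faberTail r c m =ᶠ[𝓝 v]
      fun v => ∑' n, iteratedDeriv n (faberTail r c m) 0 / n.factorial * v ^ n := by
    filter_upwards [isOpen_ball.mem_nhds (mem_ball_zero_iff.2 hv)] with w hw
    exact (hg.hasSum_taylor_faberTail m (mem_ball_zero_iff.1 hw)).tsum_eq.symm
  rw [heq.deriv_eq, (hasDerivAt_powerSeries hsummable hv).deriv]
  refine ((summable_norm_deriv_powerSeries hsummable hv).of_norm.hasSum.mul_left v).congr_fun
    fun n => ?_
  rw [faberCoeff]
  ring

theorem mul_deriv_mul_eval_derivative_faber (hg : HasExpansionAtInfinity g r c) (m : ℕ)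
    (hz : 1 < ‖z‖) :
    z * (deriv g z * (faber r c m).derivative.eval (g z)) =
      m * z ^ m - z⁻¹ * deriv (faberTail r c m) z⁻¹ := by
  have hz0 := ne_zero_of_one_lt_norm hz
  have hpoly := ((faber r c m).hasDerivAt (g z)).comp z (hg.hasDerivAt hz)
  have htail := (((hg.differentiableOn_faberTail m).differentiableAt (isOpen_ball.mem_nhds
    (mem_ball_zero_iff.2 (norm_inv_lt_one hz)))).hasDerivAt).comp z (hasDerivAt_inv hz0)
  have heq : (fun w => (faber r c m).eval w) ∘ g =ᶠ[𝓝 z]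
      (fun z => z ^ m) + faberTail r c m ∘ fun z => z⁻¹ := by
    filter_upwards [(isOpen_norm_gt 1).mem_nhds hz] with w hw using hg.eval_faber m hw
  rw [mul_comm (deriv g z),
    hpoly.unique (((hasDerivAt_pow m z).add htail).congr_of_eventuallyEq heq)]
  rcases m with _ | m
  · field_simp
    simp
  · rw [Nat.add_sub_cancel]
    field_simp
    ring

theorem hasSum_eval_faber (hg : HasExpansionAtInfinity g r c) (m : ℕ) (hz : 1 < ‖z‖) :
    HasSum (fun n => faberLaurentCoeff r c m n * z ^ n) ((faber r c m).eval (g z)) := by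
  have h := hasSum_zpow_of_natCast_of_negSucc (p := faberLaurentCoeff r c m) (m := m)
    (fun n hn => if_neg hn) (hg.hasSum_faberTail m (norm_inv_lt_one hz))
  rwa [show faberLaurentCoeff r c m m = 1 from if_pos rfl, one_mul, ← hg.eval_faber m hz] at h

theorem hasSum_mul_deriv_mul_eval_derivative_faber (hg : HasExpansionAtInfinity g r c) (m : ℕ)
    (hz : 1 < ‖z‖) :
    HasSum (fun n : ℤ => n * faberLaurentCoeff r c m n * z ^ n)
      (z * (deriv g z * (faber r c m).derivative.eval (g z))) := by
  have hneg : HasSum (fun n : ℕ =>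
      (Int.negSucc n : ℂ) * faberLaurentCoeff r c m (Int.negSucc n) * z⁻¹ ^ (n + 1))
      (-(z⁻¹ * deriv (faberTail r c m) z⁻¹)) :=
    (hg.hasSum_deriv_faberTail m (norm_inv_lt_one hz)).neg.congr_fun fun n => by
      simp only [faberLaurentCoeff, Int.cast_negSucc]
      push_cast
      ring
  have h := hasSum_zpow_of_natCast_of_negSucc
    (p := fun n => n * faberLaurentCoeff r c m n) (m := m)
    (fun n hn => by simp [show faberLaurentCoeff r c m n = 0 from if_neg hn]) hneg
  rwa [show faberLaurentCoeff r c m m = 1 from if_pos rfl, mul_one, Int.cast_natCast,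
    ← sub_eq_add_neg, ← hg.mul_deriv_mul_eval_derivative_faber m hz] at h

end HasExpansionAtInfinity

namespace IsUnivalentAtInfinity

theorem circleAverage_faber (hg : IsUnivalentAtInfinity g r c) (j k : ℕ) (hρ : 1 < ρ) :
    circleAverage (fun z => z * (deriv g z * (faber r c j).derivative.eval (g z)) *
      conj ((faber r c k).eval (g z))) 0 ρ = (π : ℂ)⁻¹ * faberGram g r c ρ j k := by
  have hgreen := hg.integral_enclosedSet_mul_conj_deriv hρ
    (p := fun w => (faber r c j).derivative.eval w) (q := fun w => (faber r c k).eval w)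
    (Polynomial.differentiable _) (Polynomial.differentiable _)
  simp only [Polynomial.deriv] at hgreen
  have hpos : 0 < ρ := one_pos.trans hρ
  have hcancel : EqOn (fun z => (z - 0)⁻¹ • (z * (deriv g z *
      (faber r c j).derivative.eval (g z)) * conj ((faber r c k).eval (g z))))
      (fun z => deriv g z * ((faber r c j).derivative.eval (g z) *
        conj ((faber r c k).eval (g z)))) (sphere 0 ρ) := fun z hz => by
    have hz0 : z ≠ 0 := ne_of_mem_sphere hz hpos.ne'
    simp only [sub_zero, smul_eq_mul]
    field_simp
  rw [Real.circleAverage_eq_circleIntegral hpos.ne', circleIntegral.integral_congr hpos.le hcancel,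
    ← hgreen, ← faberGram, smul_eq_mul]
  field_simp

theorem hasSum_faberCoeff_mul_conj_faberCoeff (hg : IsUnivalentAtInfinity g r c) (j k : ℕ)
    (hρ : 1 < ρ) :
    HasSum (fun n : ℕ => ((n : ℂ) + 1) * faberCoeff r c j n * conj (faberCoeff r c k n) *
        (ρ : ℂ)⁻¹ ^ (2 * (n + 1)))
      ((if j = k then j * (ρ : ℂ) ^ (2 * j) else 0) - (π : ℂ)⁻¹ * faberGram g r c ρ j k) := by
  have hsphere : ∀ z ∈ sphere (0 : ℂ) ρ, 1 < ‖z‖ := fun z hz => by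
    rwa [mem_sphere_zero_iff_norm.1 hz]
  have hparseval := hasSum_circleAverage_mul_conj (one_pos.trans hρ)
    (fun z hz => hg.hasSum_mul_deriv_mul_eval_derivative_faber j (hsphere z hz))
    (fun z hz => hg.hasSum_eval_faber k (hsphere z hz))
  rw [hg.circleAverage_faber j k hρ] at hparseval
  have hnat : HasSum (fun n : ℕ => ((n : ℤ) : ℂ) * faberLaurentCoeff r c j n *
      conj (faberLaurentCoeff r c k n) * (ρ : ℂ) ^ (2 * (n : ℤ)))
      (if j = k then j * (ρ : ℂ) ^ (2 * j) else 0) := by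
    refine (hasSum_ite_eq j (if j = k then j * (ρ : ℂ) ^ (2 * j) else 0)).congr_fun fun n => ?_
    change (n : ℤ) * (if n = j then (1 : ℂ) else 0) * conj (if n = k then (1 : ℂ) else 0) * _ = _
    split_ifs <;> simp_all [zpow_mul, pow_mul]
  have hneg := (hparseval.summable.comp_injective (i := Int.negSucc)
    fun _ _ h => Int.negSucc.inj h).hasSum
  have hsplit := hparseval.unique ((hnat.int_rec hneg).congr_fun fun n => by cases n <;> rfl)
  rw [hsplit, sub_add_cancel_left]
  refine hneg.neg.congr_fun fun n => ?_
  simp only [Function.comp_apply, faberLaurentCoeff, Int.cast_negSucc, zpow_mul, zpow_negSucc,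
    zpow_ofNat]
  push_cast
  rw [pow_mul, inv_pow, inv_pow]
  ring

end IsUnivalentAtInfinity

end Gram

section GramLimit

variable {g : ℂ → ℂ} {r : ℂ} {c : ℕ → ℂ} {ρ : ℝ}

theorem norm_faberCoeff_mul_conj_le (j k n : ℕ) :
    ‖((n : ℂ) + 1) * faberCoeff r c j n * conj (faberCoeff r c k n)‖ ≤
      ((n : ℝ) + 1) * ‖faberCoeff r c j n‖ ^ 2 + ((n : ℝ) + 1) * ‖faberCoeff r c k n‖ ^ 2 := by
  rw [norm_mul, norm_mul, RCLike.norm_conj, norm_natCast_add_one, mul_assoc, ← mul_add]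
  gcongr
  nlinarith [two_mul_le_add_sq ‖faberCoeff r c j n‖ ‖faberCoeff r c k n‖,
    mul_nonneg (norm_nonneg (faberCoeff r c j n)) (norm_nonneg (faberCoeff r c k n))]

theorem re_faberGram_self_nonneg (j : ℕ) : 0 ≤ (faberGram g r c ρ j j).re := by
  have hreal : faberGram g r c ρ j j =
      ((∫ w in enclosedSet g ρ, ‖(faber r c j).derivative.eval w‖ ^ 2 : ℝ) : ℂ) := by
    rw [faberGram, ← integral_complex_ofReal]
    simp only [mul_conj', ofReal_pow]
  rw [hreal, ofReal_re]
  exact integral_nonneg fun w => by positivity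

theorem HasExpansionAtInfinity.integrableOn_enclosedSet (hg : HasExpansionAtInfinity g r c)
    (hρ : 1 ≤ ρ) {F : ℂ → ℂ} (hF : Continuous F) : IntegrableOn F (enclosedSet g ρ) := by
  obtain ⟨R, hR⟩ := (hg.isBounded_enclosedSet hρ).subset_closedBall 0
  exact (hF.continuousOn.integrableOn_compact (isCompact_closedBall 0 R)).mono_set hR

namespace IsUnivalentAtInfinity

theorem sum_faberCoeff_mul_inv_pow_le (hg : IsUnivalentAtInfinity g r c) (j N : ℕ)
    (hρ : 1 < ρ) :
    ∑ n ∈ Finset.range N, ((n : ℝ) + 1) * ‖faberCoeff r c j n‖ ^ 2 * ρ⁻¹ ^ (2 * (n + 1)) ≤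
      j * ρ ^ (2 * j) := by
  have hterm : ∀ n : ℕ, ((n : ℂ) + 1) * faberCoeff r c j n * conj (faberCoeff r c j n) *
      (ρ : ℂ)⁻¹ ^ (2 * (n + 1)) =
        ((((n : ℝ) + 1) * ‖faberCoeff r c j n‖ ^ 2 * ρ⁻¹ ^ (2 * (n + 1)) : ℝ) : ℂ) := fun n => by
    rw [mul_assoc _ (faberCoeff r c j n), mul_conj']
    push_cast
    rfl
  have hre := hasSum_re ((hg.hasSum_faberCoeff_mul_conj_faberCoeff j j hρ).congr_fun
    fun n => (hterm n).symm)
  simp only [ofReal_re, if_true] at hre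
  refine (sum_le_hasSum _ (fun n _ => mul_nonneg (by positivity)
    (pow_nonneg (inv_nonneg.2 (one_pos.trans hρ).le) _)) hre).trans ?_
  rw [sub_re, ← ofReal_inv, re_ofReal_mul, ← ofReal_natCast, ← ofReal_pow,
    ← ofReal_mul, ofReal_re]
  exact sub_le_self _ (mul_nonneg (inv_nonneg.2 Real.pi_pos.le) (re_faberGram_self_nonneg j))

/-- The area theorem for the `j`-th Faber polynomial. -/
theorem sum_faberCoeff_le (hg : IsUnivalentAtInfinity g r c) (j N : ℕ) :
    ∑ n ∈ Finset.range N, ((n : ℝ) + 1) * ‖faberCoeff r c j n‖ ^ 2 ≤ (j : ℝ) := by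
  have hlhs : ContinuousAt (fun ρ : ℝ => ∑ n ∈ Finset.range N,
      ((n : ℝ) + 1) * ‖faberCoeff r c j n‖ ^ 2 * ρ⁻¹ ^ (2 * (n + 1))) 1 := by
    fun_prop (disch := norm_num)
  have hrhs : ContinuousAt (fun ρ : ℝ => (j : ℝ) * ρ ^ (2 * j)) 1 := by fun_prop
  have hle := le_of_tendsto_of_tendsto (b := 𝓝[>] 1) (hlhs.tendsto.mono_left nhdsWithin_le_nhds)
    (hrhs.tendsto.mono_left nhdsWithin_le_nhds)
    (eventually_mem_nhdsWithin.mono fun ρ hρ => hg.sum_faberCoeff_mul_inv_pow_le j N hρ)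
  simpa using hle

theorem summable_faberCoeff_sq (hg : IsUnivalentAtInfinity g r c) (j : ℕ) :
    Summable fun n : ℕ => ((n : ℝ) + 1) * ‖faberCoeff r c j n‖ ^ 2 :=
  summable_of_sum_range_le (fun n => by positivity) (hg.sum_faberCoeff_le j)

theorem tendsto_setIntegral_enclosedSet (hg : IsUnivalentAtInfinity g r c) {F : ℂ → ℂ}
    (hF : Continuous F) {u : ℕ → ℝ} (hanti : Antitone u) (hone : ∀ N, 1 < u N)
    (hlim : Tendsto u atTop (𝓝 1)) :
    Tendsto (fun N => ∫ w in enclosedSet g (u N), F w) atTop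
      (𝓝 (∫ w in enclosedSet g 1, F w)) := by
  have hinter : ⋂ N, enclosedSet g (u N) = enclosedSet g 1 := by
    have hunion : ⋃ N, {z : ℂ | u N < ‖z‖} = {z | 1 < ‖z‖} := by
      ext z
      simp only [mem_iUnion, mem_ofPred_eq]
      exact ⟨fun ⟨N, hN⟩ => (hone N).trans hN, fun hz => (hlim.eventually_lt_const hz).exists⟩
    simp only [enclosedSet]
    rw [← compl_iUnion, ← image_iUnion, hunion]
  rw [← hinter]
  refine tendsto_setIntegral_of_antitone
    (fun N => hg.measurableSet_enclosedSet (hone N).le)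
    (fun M N h => compl_subset_compl.2 (image_mono fun z hz => (hanti h).trans_lt hz))
    ⟨0, hg.integrableOn_enclosedSet (hone 0).le hF⟩

theorem tendsto_tsum_faberCoeff_mul_conj (hg : IsUnivalentAtInfinity g r c) (j k : ℕ)
    {u : ℕ → ℝ} (hone : ∀ N, 1 < u N) (hlim : Tendsto u atTop (𝓝 1)) :
    Tendsto (fun N => ∑' n : ℕ, ((n : ℂ) + 1) * faberCoeff r c j n * conj (faberCoeff r c k n) *
        (u N : ℂ)⁻¹ ^ (2 * (n + 1))) atTop
      (𝓝 (∑' n : ℕ, ((n : ℂ) + 1) * faberCoeff r c j n * conj (faberCoeff r c k n))) := by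
  have hlim' : Tendsto (fun N => (u N : ℂ)⁻¹) atTop (𝓝 1) := by
    simpa using ((continuous_ofReal.tendsto 1).comp hlim).inv₀ (by simp)
  refine tendsto_tsum_of_dominated_convergence
    ((hg.summable_faberCoeff_sq j).add (hg.summable_faberCoeff_sq k)) (fun n => ?_)
    (Eventually.of_forall fun N n => ?_)
  · simpa using (hlim'.pow (2 * (n + 1))).const_mul
      (((n : ℂ) + 1) * faberCoeff r c j n * conj (faberCoeff r c k n))
  · have hinv : ‖(u N : ℂ)⁻¹‖ ≤ 1 := by
      rw [norm_inv, norm_real, Real.norm_of_nonneg (one_pos.trans (hone N)).le]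
      exact inv_le_one_of_one_le₀ (hone N).le
    rw [norm_mul, norm_pow]
    exact (mul_le_of_le_one_right (norm_nonneg _) (pow_le_one₀ (norm_nonneg _) hinv)).trans
      (norm_faberCoeff_mul_conj_le j k n)

theorem faberGram_one (hg : IsUnivalentAtInfinity g r c) (j k : ℕ) :
    faberGram g r c 1 j k = π * ((if j = k then (j : ℂ) else 0) -
      ∑' n : ℕ, ((n : ℂ) + 1) * faberCoeff r c j n * conj (faberCoeff r c k n)) := by
  obtain ⟨u, hanti, hone, hlim⟩ := exists_seq_strictAnti_tendsto (1 : ℝ)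
  have hpi : (π : ℂ) ≠ 0 := ofReal_ne_zero.2 Real.pi_ne_zero
  have hgram : ∀ N, faberGram g r c (u N) j k =
      π * ((if j = k then j * (u N : ℂ) ^ (2 * j) else 0) -
        ∑' n : ℕ, ((n : ℂ) + 1) * faberCoeff r c j n * conj (faberCoeff r c k n) *
          (u N : ℂ)⁻¹ ^ (2 * (n + 1))) := fun N => by
    rw [(hg.hasSum_faberCoeff_mul_conj_faberCoeff j k (hone N)).tsum_eq, sub_sub_cancel,
      mul_inv_cancel_left₀ hpi]
  have hdiag : Tendsto (fun N => if j = k then j * (u N : ℂ) ^ (2 * j) else 0) atTop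
      (𝓝 (if j = k then (j : ℂ) else 0)) := by
    split_ifs
    · simpa using (((continuous_ofReal.tendsto 1).comp hlim).pow (2 * j)).const_mul (j : ℂ)
    · exact tendsto_const_nhds
  refine tendsto_nhds_unique (hg.tendsto_setIntegral_enclosedSet
    ((Polynomial.continuous _).mul (continuous_conj.comp (Polynomial.continuous _)))
    hanti.antitone hone hlim) ?_
  change Tendsto (fun N => faberGram g r c (u N) j k) _ _
  simp only [hgram]
  exact (hdiag.sub (hg.tendsto_tsum_faberCoeff_mul_conj j k hone hlim)).const_mul _

end IsUnivalentAtInfinity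

end GramLimit

/-! ### Grunsky coefficients -/

section Expansion

open scoped PowerSeries

open PowerSeries (coeff constantCoeff)

/-- The Grunsky coefficients of `g z = r z + c₀ + c₁ / z + ⋯`. -/
noncomputable def grunskyCoeff (r : ℂ) (c : ℕ → ℂ) (k l : ℕ+) : ℂ :=
  faberCoeff r c k l.natPred / k

variable {a b s : ℂ⟦X⟧} {g : ℂ → ℂ} {r : ℂ} {c : ℕ → ℂ} {R : ℝ} {u v z ζ : ℂ}

theorem eq_mul_exp_sub_of_hasDerivAt {U : Set ℂ} (hU : IsOpen U) (hUc : IsPreconnected U)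
    {F S S' : ℂ → ℂ} (hF : ∀ u ∈ U, HasDerivAt F (F u * S' u) u)
    (hS : ∀ u ∈ U, HasDerivAt S (S' u) u) (hu : u ∈ U) (hv : v ∈ U) :
    F u = F v * cexp (S u - S v) := by
  have hderiv : ∀ w ∈ U, HasDerivAt (fun w => F w * cexp (-S w)) 0 w := fun w hw =>
    ((hF w hw).mul (hS w hw).neg.cexp).congr_deriv (by ring)
  have hconst : F u * cexp (-S u) = F v * cexp (-S v) :=
    hU.is_const_of_deriv_eq_zero hUc
      (fun w hw => (hderiv w hw).differentiableAt.differentiableWithinAt)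
      (fun w hw => (hderiv w hw).deriv) hu hv
  calc F u = F u * cexp (-S u) * cexp (S u) := by rw [mul_assoc, ← Complex.exp_add]; simp
    _ = F v * cexp (S u - S v) := by
      rw [hconst, mul_assoc, ← Complex.exp_add, neg_add_eq_sub]

theorem tsum_coeff_mul (ha : Summable fun k => coeff k a * u ^ k)
    (hb : Summable fun k => coeff k b * u ^ k) :
    ∑' k, coeff k (a * b) * u ^ k = (∑' k, coeff k a * u ^ k) * ∑' k, coeff k b * u ^ k := by
  rw [tsum_mul_tsum_eq_tsum_sum_antidiagonal_of_summable_norm ha.norm hb.norm]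
  refine tsum_congr fun k => ?_
  rw [PowerSeries.coeff_mul, Finset.sum_mul]
  refine Finset.sum_congr rfl fun p hp => ?_
  rw [← Finset.HasAntidiagonal.mem_antidiagonal.1 hp, pow_add]
  ring

theorem summable_coeff_derivative (ha : ∀ u : ℂ, ‖u‖ < R → Summable fun k => coeff k a * u ^ k)
    (hu : ‖u‖ < R) : Summable fun k => coeff k (d⁄dX ℂ a) * u ^ k :=
  (summable_norm_deriv_powerSeries ha hu).of_norm.congr fun k => by
    rw [PowerSeries.coeff_derivative, mul_comm (coeff _ a)]

theorem hasDerivAt_tsum_coeff (ha : ∀ u : ℂ, ‖u‖ < R → Summable fun k => coeff k a * u ^ k)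
    (hu : ‖u‖ < R) :
    HasDerivAt (fun u => ∑' k, coeff k a * u ^ k) (∑' k, coeff k (d⁄dX ℂ a) * u ^ k) u :=
  (hasDerivAt_powerSeries ha hu).congr_deriv <| tsum_congr fun k => by
    rw [PowerSeries.coeff_derivative, mul_comm (coeff _ a)]

theorem tsum_coeff_mul_zero_pow : ∑' k, coeff k a * 0 ^ k = constantCoeff a := by
  rw [tsum_eq_single 0 fun k hk => by rw [zero_pow hk, mul_zero]]
  simp

theorem exp_tsum_coeff (ha : ∀ u : ℂ, ‖u‖ < R → Summable fun k => coeff k a * u ^ k)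
    (hs : ∀ u : ℂ, ‖u‖ < R → Summable fun k => coeff k s * u ^ k)
    (hode : d⁄dX ℂ a = a * d⁄dX ℂ s) (ha₀ : constantCoeff a = 1) (hs₀ : constantCoeff s = 0)
    (hu : ‖u‖ < R) :
    cexp (∑' k, coeff k s * u ^ k) = ∑' k, coeff k a * u ^ k := by
  have hderiv : ∀ w ∈ ball (0 : ℂ) R, HasDerivAt (fun u => ∑' k, coeff k a * u ^ k)
      ((∑' k, coeff k a * w ^ k) * ∑' k, coeff k (d⁄dX ℂ s) * w ^ k) w := fun w hw => by
    rw [mem_ball_zero_iff] at hw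
    rw [← tsum_coeff_mul (ha w hw) (summable_coeff_derivative hs hw), ← hode]
    exact hasDerivAt_tsum_coeff ha hw
  have h := eq_mul_exp_sub_of_hasDerivAt isOpen_ball (convex_ball (0 : ℂ) R).isPreconnected hderiv
    (fun w hw => hasDerivAt_tsum_coeff hs (mem_ball_zero_iff.1 hw)) (mem_ball_zero_iff.2 hu)
    (mem_ball_self ((norm_nonneg u).trans_lt hu))
  rw [h, tsum_coeff_mul_zero_pow, tsum_coeff_mul_zero_pow, ha₀, hs₀, one_mul, sub_zero]

theorem summable_powerSeries_add (hc : ∀ v : ℂ, ‖v‖ < R → Summable fun k => c k * v ^ k)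
    (hu : ‖u‖ < R) (hv : ‖v‖ < R) :
    Summable fun p : ℕ × ℕ => c (p.1 + p.2) * u ^ p.1 * v ^ p.2 := by
  obtain ⟨t, hmax, htR⟩ := exists_between (max_lt hu hv)
  obtain ⟨hut, hvt⟩ := max_lt_iff.1 hmax
  have ht : 0 < t := (norm_nonneg u).trans_lt hut
  obtain ⟨M, hM⟩ := exists_norm_coeff_le ht (hc t (by rwa [norm_real, Real.norm_of_nonneg ht.le]))
  have hgeom : ∀ {w : ℂ}, ‖w‖ < t → Summable fun k : ℕ => (‖w‖ / t) ^ k := fun hw =>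
    summable_geometric_of_lt_one (by positivity) ((div_lt_one ht).2 hw)
  refine Summable.of_norm_bounded (((hgeom hut).mul_of_nonneg (hgeom hvt)
    (fun _ => by positivity) (fun _ => by positivity)).mul_left M) fun p => ?_
  calc ‖c (p.1 + p.2) * u ^ p.1 * v ^ p.2‖
      ≤ M / t ^ (p.1 + p.2) * ‖u‖ ^ p.1 * ‖v‖ ^ p.2 := by
        rw [norm_mul, norm_mul, norm_pow, norm_pow]
        gcongr
        exact hM _
    _ = M * ((‖u‖ / t) ^ p.1 * (‖v‖ / t) ^ p.2) := by
        rw [div_pow, div_pow, pow_add]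
        field_simp

theorem kernelSeries_derivative :
    d⁄dX ℂ (kernelSeries r c v) =
      kernelSeries r c v * d⁄dX ℂ (.mk fun k => -(faberTail r c k v / k)) := by
  have hmk : (.mk fun m => faberTail r c m v) =
      -(PowerSeries.X * d⁄dX ℂ (.mk fun k => -(faberTail r c k v / k)) : ℂ⟦X⟧) := by
    ext m
    rcases m with _ | m
    · simp [faberTail]
    · rw [map_neg, PowerSeries.coeff_succ_X_mul, PowerSeries.coeff_derivative]
      simp only [PowerSeries.coeff_mk, Nat.cast_succ]
      field_simp [Nat.cast_add_one_ne_zero (R := ℂ) m]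
  have h := kernelSeries_mul_mk_faberTail (r := r) (c := c) (v := v)
  rw [hmk, mul_neg, neg_inj, mul_left_comm] at h
  exact (mul_left_cancel₀ PowerSeries.X_ne_zero h).symm

namespace HasExpansionAtInfinity

theorem summable_coeff_kernelSeries (hg : HasExpansionAtInfinity g r c) (hu : ‖u‖ < 1)
    (hv : ‖v‖ < 1) : Summable fun i => coeff i (kernelSeries r c v) * u ^ i := by
  refine (summable_nat_add_iff 1).1 ?_
  refine ((summable_nat_add_iff 1).2
    ((summable_powerSeries_add hg.summable hu hv).prod.mul_left (-(v / r)))).congr fun i => ?_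
  simp only [kernelSeries, PowerSeries.coeff_mk, Nat.succ_ne_zero, if_false,
    mul_right_comm _ (u ^ _), tsum_mul_right]
  ring

theorem hasSum_differenceSeries (hg : HasExpansionAtInfinity g r c) (w : ℂ) (hζ : 1 < ‖ζ‖) :
    HasSum (fun k => coeff k (differenceSeries r c w) * ζ⁻¹ ^ k) ((g ζ - w) / (r * ζ)) := by
  have hr := hg.ne_zero
  have hζ0 := ne_zero_of_one_lt_norm hζ
  have h := ((hg.hasSum ζ hζ).sub (hasSum_ite_eq 0 w)).mul_left (ζ⁻¹ / r)
  have hval : (g ζ - w) / (r * ζ) -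
      ∑ i ∈ Finset.range 1, coeff i (differenceSeries r c w) * ζ⁻¹ ^ i =
        ζ⁻¹ / r * (g ζ - r * ζ - w) := by
    simp only [Finset.sum_range_one, differenceSeries, PowerSeries.coeff_mk, pow_zero]
    field_simp
    ring
  refine (hasSum_nat_add_iff' 1).1 (hval ▸ h.congr_fun fun k => ?_)
  simp only [differenceSeries, PowerSeries.coeff_mk]
  split_ifs with hk
  · rw [hk]
    ring
  · ring

theorem tsum_coeff_kernelSeries (hg : HasExpansionAtInfinity g r c) (hζ : 1 < ‖ζ‖) (hz : 1 < ‖z‖)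
    (hne : ζ ≠ z) :
    ∑' i, coeff i (kernelSeries r c z⁻¹) * ζ⁻¹ ^ i = (g ζ - g z) / (r * (ζ - z)) := by
  have hfactor : HasSum (fun k => coeff k (1 - PowerSeries.C z * PowerSeries.X) * ζ⁻¹ ^ k)
      (1 - z * ζ⁻¹) := by
    have hzero : ∀ k ∉ Finset.range 2,
        coeff k (1 - PowerSeries.C z * PowerSeries.X) * ζ⁻¹ ^ k = 0 := fun k hk => by
      have hk : 1 < k := by simpa using hk
      simp [PowerSeries.coeff_one, PowerSeries.coeff_X, hk.ne', (zero_lt_one.trans hk).ne']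
    simpa [Finset.sum_range_succ, PowerSeries.coeff_one, PowerSeries.coeff_X, sub_eq_add_neg]
      using hasSum_sum_of_ne_finset_zero hzero
  have h := tsum_coeff_mul hfactor.summable
    (hg.summable_coeff_kernelSeries (norm_inv_lt_one hζ) (norm_inv_lt_one hz))
  rw [← hg.differenceSeries_eq_mul_kernelSeries hz, hfactor.tsum_eq,
    (hg.hasSum_differenceSeries (g z) hζ).tsum_eq] at h
  have hr := hg.ne_zero
  have hζ0 := ne_zero_of_one_lt_norm hζ
  have hsub := sub_ne_zero.2 hne
  rw [eq_div_iff (mul_ne_zero hr hsub)]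
  generalize ∑' i, coeff i (kernelSeries r c z⁻¹) * ζ⁻¹ ^ i = Ψ at h ⊢
  field_simp at h
  linear_combination -h

end HasExpansionAtInfinity

namespace IsUnivalentAtInfinity

theorem norm_faberCoeff_le (hg : IsUnivalentAtInfinity g r c) (m n : ℕ) :
    ‖faberCoeff r c m n‖ ≤ m := by
  have hterm : ((n : ℝ) + 1) * ‖faberCoeff r c m n‖ ^ 2 ≤ m :=
    (Finset.single_le_sum (f := fun n : ℕ => ((n : ℝ) + 1) * ‖faberCoeff r c m n‖ ^ 2)
      (fun i _ => by positivity) (Finset.self_mem_range_succ n)).trans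
      (hg.sum_faberCoeff_le m (n + 1))
  have hsq : (m : ℝ) ≤ (m : ℝ) ^ 2 := mod_cast Nat.le_self_pow two_ne_zero m
  exact le_of_sq_le_sq ((le_mul_of_one_le_left (by positivity) (by simp)).trans
    (hterm.trans hsq)) m.cast_nonneg

theorem norm_grunskyCoeff_le (hg : IsUnivalentAtInfinity g r c) (k l : ℕ+) :
    ‖grunskyCoeff r c k l‖ ≤ 1 := by
  rw [grunskyCoeff, norm_div, Complex.norm_natCast]
  exact div_le_one_of_le₀ (hg.norm_faberCoeff_le _ _) (by positivity)

theorem summable_grunskyCoeff (hg : IsUnivalentAtInfinity g r c) (hu : ‖u‖ < 1) (hv : ‖v‖ < 1) :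
    Summable fun p : ℕ+ × ℕ+ => -(grunskyCoeff r c p.1 p.2 * u ^ (p.1 : ℕ) * v ^ (p.2 : ℕ)) := by
  have hgeom : ∀ {w : ℂ}, ‖w‖ < 1 → Summable fun k : ℕ+ => ‖w‖ ^ (k : ℕ) := fun hw =>
    (summable_geometric_of_lt_one (norm_nonneg _) hw).comp_injective PNat.coe_injective
  refine Summable.of_norm_bounded ((hgeom hu).mul_of_nonneg (hgeom hv)
    (fun _ => by positivity) (fun _ => by positivity)) fun p => ?_
  rw [norm_neg, norm_mul, norm_mul, norm_pow, norm_pow]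
  gcongr
  exact mul_le_of_le_one_left (by positivity) (hg.norm_grunskyCoeff_le _ _)

theorem hasSum_neg_faberTail_div (hg : IsUnivalentAtInfinity g r c) (hu : ‖u‖ < 1)
    (hv : ‖v‖ < 1) :
    HasSum (fun k : ℕ => -(faberTail r c k v / k) * u ^ k)
      (∑' p : ℕ+ × ℕ+, -(grunskyCoeff r c p.1 p.2 * u ^ (p.1 : ℕ) * v ^ (p.2 : ℕ))) := by
  have hfiber : ∀ k : ℕ+, HasSum
      (fun l : ℕ+ => -(grunskyCoeff r c k l * u ^ (k : ℕ) * v ^ (l : ℕ)))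
      (-(faberTail r c k v / k) * u ^ (k : ℕ)) := fun k => by
    have h := (Equiv.pnatEquivNat.hasSum_iff.2 (hg.hasSum_faberTail k hv)).mul_left
      (-(u ^ (k : ℕ) / k))
    rw [neg_mul, div_mul_comm, ← neg_mul]
    refine h.congr_fun fun l => ?_
    simp only [Function.comp_apply, Equiv.pnatEquivNat_apply, grunskyCoeff, PNat.natPred_add_one]
    ring
  refine (PNat.coe_injective.hasSum_iff fun k hk => ?_).1
    ((hg.summable_grunskyCoeff hu hv).hasSum.prod_fiberwise hfiber)
  have hk0 : k = 0 := by
    by_contra h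
    exact hk ⟨⟨k, Nat.pos_of_ne_zero h⟩, rfl⟩
  simp [hk0]

theorem exists_hasSum_grunskyCoeff (hg : IsUnivalentAtInfinity g r c) (hζ : 1 < ‖ζ‖)
    (hz : 1 < ‖z‖) (hne : ζ ≠ z) :
    ∃ L, HasSum (fun p : ℕ+ × ℕ+ =>
        -(grunskyCoeff r c p.1 p.2 * ζ⁻¹ ^ (p.1 : ℕ) * z⁻¹ ^ (p.2 : ℕ))) L ∧
      cexp L = (g ζ - g z) / (r * (ζ - z)) := by
  have hu := norm_inv_lt_one hζ
  have hv := norm_inv_lt_one hz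
  refine ⟨_, (hg.summable_grunskyCoeff hu hv).hasSum, ?_⟩
  have hexp := exp_tsum_coeff (s := .mk fun k => -(faberTail r c k z⁻¹ / k))
    (fun u hu => hg.summable_coeff_kernelSeries hu hv)
    (fun u hu => by simpa using (hg.hasSum_neg_faberTail_div hu hv).summable)
    kernelSeries_derivative constantCoeff_kernelSeries (by simp) hu
  simp only [PowerSeries.coeff_mk] at hexp
  rw [← (hg.hasSum_neg_faberTail_div hu hv).tsum_eq, hexp, hg.tsum_coeff_kernelSeries hζ hz hne]

end IsUnivalentAtInfinity

end Expansion

/-! ### The Grunsky operator and its truncations -/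

section Truncation

theorem detOneSub_eq_det {ι E : Type*} [Fintype ι] [DecidableEq ι] [AddCommGroup E] [Module ℂ E]
    [TopologicalSpace E] (T : E →L[ℂ] E) (S : (ι → ℂ) →ₗ[ℂ] E) (S' : E →ₗ[ℂ] ι → ℂ)
    (hS : S' ∘ₗ S = LinearMap.id) (M : Matrix ι ι ℂ)
    (hT : (T : E →ₗ[ℂ] E) = S ∘ₗ Matrix.toLin' M ∘ₗ S') :
    detOneSub T = (1 - M).det := by
  let W := LinearMap.range (T : E →ₗ[ℂ] E)
  have hSS' : ∀ x, S' (S x) = x := LinearMap.congr_fun hS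
  have hfin : FiniteDimensional ℂ W := by
    refine Submodule.finiteDimensional_of_le (S₂ := LinearMap.range S) ?_
    simp only [W, hT]
    exact LinearMap.range_comp_le_range _ _
  let X : W →ₗ[ℂ] ι → ℂ := S' ∘ₗ W.subtype
  let Y : (ι → ℂ) →ₗ[ℂ] W := (S ∘ₗ Matrix.toLin' M).codRestrict W fun x => ⟨S x, by
    rw [hT, LinearMap.comp_apply, LinearMap.comp_apply, hSS', LinearMap.comp_apply]⟩
  have hYX : (T : E →ₗ[ℂ] E).restrict (p := W) (q := W)
      (fun x _ => LinearMap.mem_range_self (T : E →ₗ[ℂ] E) x) = Y ∘ₗ X :=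
    LinearMap.ext fun x => Subtype.ext (LinearMap.congr_fun hT x)
  have hXY : X ∘ₗ Y = Matrix.toLin' M := LinearMap.ext fun x => hSS' _
  let b := Module.finBasis ℂ W
  let e := Pi.basisFun ℂ ι
  have hM : LinearMap.toMatrix e e (X ∘ₗ Y) = M := by
    rw [hXY]
    exact LinearMap.toMatrix'_toLin' M
  rw [detOneSub, hYX, ← LinearMap.det_toMatrix b, map_sub, LinearMap.toMatrix_id,
    LinearMap.toMatrix_comp b e b, Matrix.det_one_sub_mul_comm, ← LinearMap.toMatrix_comp e b e, hM]

theorem inner_ellBasis (k : ℕ+) (x : EllTwo) : inner ℂ (ellBasis k) x = x k := by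
  simp [ellBasis, lp.inner_single_left]

theorem ellBasis_apply (k l : ℕ+) : ellBasis k l = if l = k then 1 else 0 := by
  simp [ellBasis, lp.single_apply, Pi.single_apply]

theorem orthonormal_ellBasis : Orthonormal ℂ ellBasis :=
  orthonormal_iff_ite.2 fun i j => by rw [inner_ellBasis, ellBasis_apply]

theorem summable_norm_sq (x : EllTwo) : Summable fun k => ‖x k‖ ^ 2 := by
  simpa using (lp.memℓp x).summable (by norm_num)

theorem sum_norm_sq_le (x : EllTwo) (s : Finset ℕ+) : ∑ k ∈ s, ‖x k‖ ^ 2 ≤ ‖x‖ ^ 2 := by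
  simpa using lp.sum_rpow_le_norm_rpow (p := 2) (by norm_num) x s

theorem exists_clm_apply_ellBasis {E : Type*} [NormedAddCommGroup E] [NormedSpace ℂ E]
    [CompleteSpace E] {e : ℕ+ → E}
    (he : ∀ (s : Finset ℕ+) (x : ℕ+ → ℂ), ‖∑ k ∈ s, x k • e k‖ ^ 2 ≤ ∑ k ∈ s, ‖x k‖ ^ 2) :
    ∃ C : EllTwo →L[ℂ] E, ∀ k, C (ellBasis k) = e k := by
  have hsum : ∀ x : EllTwo, Summable fun k => x k • e k := fun x => by
    refine summable_iff_vanishing_norm.2 fun ε hε => ?_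
    obtain ⟨s, hs⟩ := summable_iff_vanishing_norm.1 (summable_norm_sq x) (ε ^ 2) (by positivity)
    exact ⟨s, fun t ht => lt_of_pow_lt_pow_left₀ 2 hε.le
      ((he t x).trans_lt ((le_abs_self _).trans_lt (hs t ht)))⟩
  let C : EllTwo →ₗ[ℂ] E :=
    { toFun := fun x => ∑' k, x k • e k
      map_add' := fun x y => by
        rw [← (hsum x).tsum_add (hsum y)]
        exact tsum_congr fun k => add_smul _ _ _
      map_smul' := fun a x => by
        rw [RingHom.id_apply, ← (hsum x).tsum_const_smul a]
        exact tsum_congr fun k => mul_smul a (x k) (e k) }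
  refine ⟨C.mkContinuous 1 fun x => ?_, fun k => ?_⟩
  · rw [one_mul]
    exact le_of_tendsto (hsum x).hasSum.norm (Eventually.of_forall fun s =>
      le_of_sq_le_sq ((he s x).trans (sum_norm_sq_le x s)) (norm_nonneg x))
  · change ∑' l, ellBasis k l • e l = e k
    simp only [ellBasis_apply, ite_smul, one_smul, zero_smul, tsum_ite_eq]

theorem truncProj_apply (n : ℕ) (x : EllTwo) :
    truncProj n x = ∑ i : Fin n, x (i : ℕ).succPNat • ellBasis (i : ℕ).succPNat := by
  simp only [truncProj, sum_apply, InnerProductSpace.rankOne_apply, inner_ellBasis,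
    Finset.sum_range]

/-- The matrix of inner products of the images of the first `n` basis vectors under `C`, that is,
the compression of `C^* C` to the first `n` coordinates. -/
noncomputable def truncGram (n : ℕ) (C : EllTwo →L[ℂ] EllTwo) : Matrix (Fin n) (Fin n) ℂ :=
  .of fun i j => inner ℂ (C (ellBasis (i : ℕ).succPNat)) (C (ellBasis (j : ℕ).succPNat))

theorem truncDet_adjoint (n : ℕ) (C : EllTwo →L[ℂ] EllTwo) :
    truncDet n (ContinuousLinearMap.adjoint C) = (1 - truncGram n C).det := by
  let e : Fin n → EllTwo := fun i => ellBasis (i : ℕ).succPNat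
  let S : (Fin n → ℂ) →ₗ[ℂ] EllTwo := Fintype.linearCombination ℂ e
  let S' : EllTwo →ₗ[ℂ] Fin n → ℂ := LinearMap.pi fun i => (innerSL ℂ (e i) : EllTwo →ₗ[ℂ] ℂ)
  have hS : ∀ x, S x = ∑ i, x i • e i := fun _ => rfl
  have hS' : ∀ x i, S' x i = inner ℂ (e i) x := fun _ _ => rfl
  have he : Orthonormal ℂ e :=
    orthonormal_ellBasis.comp _ (Nat.succPNat_injective.comp Fin.val_injective)
  have hP : ∀ x, truncProj n x = S (S' x) := fun x => by
    simp only [truncProj_apply, hS, hS', e, inner_ellBasis]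
  refine detOneSub_eq_det _ S S' (LinearMap.ext fun x => funext fun i => ?_) _
    (LinearMap.ext fun x => ?_)
  · rw [LinearMap.comp_apply, hS', hS]
    exact he.inner_right_fintype x i
  · simp only [ContinuousLinearMap.coe_coe, ContinuousLinearMap.comp_apply,
      ContinuousLinearMap.adjoint_adjoint, LinearMap.comp_apply, hP]
    congr 1
    ext i
    simp only [hS', ContinuousLinearMap.adjoint_inner_right, hS, Matrix.toLin'_apply,
      Matrix.mulVec, dotProduct, map_sum, inner_sum, map_smul, inner_smul_right, truncGram,
      Matrix.of_apply, mul_comm, e]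

end Truncation

section GrunskyOperator

variable {g : ℂ → ℂ} {r : ℂ} {c : ℕ → ℂ}

theorem sqrt_natCast_mul_self (m : ℕ) : (√(m : ℝ) : ℂ) * (√(m : ℝ) : ℂ) = m := by
  rw [← ofReal_mul, Real.mul_self_sqrt m.cast_nonneg, ofReal_natCast]

theorem natCast_mul_grunskyCoeff (k l : ℕ+) :
    (k : ℂ) * grunskyCoeff r c k l = faberCoeff r c k l.natPred :=
  mul_div_cancel₀ _ (Nat.cast_ne_zero.2 k.ne_zero)

theorem norm_sq_sqrt_mul_grunskyCoeff (k l : ℕ+) :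
    ‖(√((k : ℝ) * l) : ℂ) * grunskyCoeff r c k l‖ ^ 2 =
      (k : ℝ)⁻¹ * (((l.natPred : ℝ) + 1) * ‖faberCoeff r c k l.natPred‖ ^ 2) := by
  have hl : (l.natPred : ℝ) + 1 = l := mod_cast l.natPred_add_one
  rw [hl, ← natCast_mul_grunskyCoeff, norm_mul, norm_mul, Complex.norm_natCast, norm_real,
    Real.norm_of_nonneg (Real.sqrt_nonneg _), mul_pow, Real.sq_sqrt (by positivity)]
  field_simp

theorem sum_mul_integral_mul_conj {α ι : Type*} {mα : MeasurableSpace α} {μ : Measure α}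
    {s : Finset ι} {φ : ι → α → ℂ}
    (hφ : ∀ j ∈ s, ∀ k ∈ s, Integrable (fun w => φ j w * conj (φ k w)) μ) (y : ι → ℂ) :
    ∑ j ∈ s, ∑ k ∈ s, y j * conj (y k) * ∫ w, φ j w * conj (φ k w) ∂μ =
      ((∫ w, ‖∑ j ∈ s, y j * φ j w‖ ^ 2 ∂μ : ℝ) : ℂ) := by
  have hexpand : ∀ w, ((‖∑ j ∈ s, y j * φ j w‖ ^ 2 : ℝ) : ℂ) =
      ∑ j ∈ s, ∑ k ∈ s, y j * conj (y k) * (φ j w * conj (φ k w)) := fun w => by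
    rw [ofReal_pow, ← mul_conj', map_sum, Finset.sum_mul_sum]
    refine Finset.sum_congr rfl fun j _ => Finset.sum_congr rfl fun k _ => ?_
    rw [map_mul]
    ring
  rw [← integral_complex_ofReal]
  simp only [hexpand]
  rw [integral_finsetSum _ fun j hj => integrable_finsetSum _ fun k hk =>
    (hφ j hj k hk).const_mul _]
  refine Finset.sum_congr rfl fun j hj => ?_
  rw [integral_finsetSum _ fun k hk => (hφ j hj k hk).const_mul _]
  simp only [integral_const_mul]

theorem ofReal_norm_sq_sum_smul {E ι : Type*} [SeminormedAddCommGroup E] [InnerProductSpace ℂ E]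
    (s : Finset ι) (x : ι → ℂ) (e : ι → E) :
    ((‖∑ k ∈ s, x k • e k‖ ^ 2 : ℝ) : ℂ) =
      ∑ j ∈ s, ∑ k ∈ s, conj (x j) * x k * inner ℂ (e j) (e k) := by
  rw [ofReal_pow]
  refine (inner_self_eq_norm_sq_to_K (𝕜 := ℂ) _).symm.trans ?_
  rw [sum_inner]
  simp only [inner_sum, inner_smul_left, inner_smul_right, mul_assoc, mul_left_comm]

namespace IsUnivalentAtInfinity

theorem memℓp_grunskyRow (hg : IsUnivalentAtInfinity g r c) (k : ℕ+) :
    Memℓp (fun l : ℕ+ => conj ((√((k : ℝ) * l) : ℂ) * grunskyCoeff r c k l)) 2 := by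
  refine memℓp_gen (((Equiv.pnatEquivNat.summable_iff.2
    (hg.summable_faberCoeff_sq k)).mul_left (k : ℝ)⁻¹).congr fun l => ?_)
  rw [ENNReal.toReal_ofNat, Real.rpow_ofNat, RCLike.norm_conj, norm_sq_sqrt_mul_grunskyCoeff]
  rfl

/-- The complex conjugate of the `k`-th row of the matrix `(√(k l) a k l)`. -/
noncomputable def grunskyRow (hg : IsUnivalentAtInfinity g r c) (k : ℕ+) : EllTwo :=
  ⟨_, hg.memℓp_grunskyRow k⟩

theorem grunskyRow_apply (hg : IsUnivalentAtInfinity g r c) (k l : ℕ+) :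
    hg.grunskyRow k l = conj ((√((k : ℝ) * l) : ℂ) * grunskyCoeff r c k l) := rfl

theorem sqrt_mul_inner_grunskyRow_mul_sqrt (hg : IsUnivalentAtInfinity g r c) (j k : ℕ+) :
    √(j : ℝ) * inner ℂ (hg.grunskyRow j) (hg.grunskyRow k) * √(k : ℝ) =
      ∑' n : ℕ, ((n : ℂ) + 1) * faberCoeff r c j n * conj (faberCoeff r c k n) := by
  have hterm : ∀ l : ℕ+, √(j : ℝ) * inner ℂ (hg.grunskyRow j l) (hg.grunskyRow k l) * √(k : ℝ) =
      ((l.natPred : ℂ) + 1) * faberCoeff r c j l.natPred * conj (faberCoeff r c k l.natPred) :=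
    fun l => by
    have hl : (l.natPred : ℂ) + 1 = l := mod_cast l.natPred_add_one
    rw [hl, ← natCast_mul_grunskyCoeff, ← natCast_mul_grunskyCoeff, grunskyRow_apply,
      grunskyRow_apply, RCLike.inner_apply, Complex.conj_conj, Real.sqrt_mul (by positivity),
      Real.sqrt_mul (by positivity)]
    simp only [map_mul, conj_ofReal, ofReal_mul, map_natCast]
    rw [← sqrt_natCast_mul_self l, ← sqrt_natCast_mul_self j, ← sqrt_natCast_mul_self k]
    ring
  have h := ((lp.hasSum_inner (𝕜 := ℂ) (hg.grunskyRow j) (hg.grunskyRow k)).mul_left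
    (√(j : ℝ) : ℂ)).mul_right (√(k : ℝ) : ℂ)
  rw [← h.tsum_eq, ← Equiv.pnatEquivNat.tsum_eq]
  exact tsum_congr hterm

theorem faberGram_one_eq_inner (hg : IsUnivalentAtInfinity g r c) (j k : ℕ+) :
    faberGram g r c 1 j k = π * (√(j : ℝ) *
      ((if j = k then 1 else 0) - inner ℂ (hg.grunskyRow j) (hg.grunskyRow k)) * √(k : ℝ)) := by
  rw [hg.faberGram_one, ← hg.sqrt_mul_inner_grunskyRow_mul_sqrt, mul_sub (√_ : ℂ), sub_mul]
  rcases eq_or_ne j k with rfl | hjk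
  · rw [if_pos rfl, if_pos rfl, mul_one, sqrt_natCast_mul_self]
  · rw [if_neg hjk, if_neg (PNat.coe_injective.ne hjk), mul_zero, zero_mul]

theorem norm_sum_grunskyRow_le (hg : IsUnivalentAtInfinity g r c) (s : Finset ℕ+) (x : ℕ+ → ℂ) :
    ‖∑ k ∈ s, x k • hg.grunskyRow k‖ ^ 2 ≤ ∑ k ∈ s, ‖x k‖ ^ 2 := by
  let y : ℕ+ → ℂ := fun j => conj (x j) / √(j : ℝ)
  let A : ℝ := ∫ w in enclosedSet g 1, ‖∑ j ∈ s, y j * (faber r c j).derivative.eval w‖ ^ 2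
  have hsqrt : ∀ j : ℕ+, (√(j : ℝ) : ℂ) ≠ 0 := fun j =>
    ofReal_ne_zero.2 (Real.sqrt_pos.2 (Nat.cast_pos.2 j.pos)).ne'
  have hgram : ∑ j ∈ s, ∑ k ∈ s, y j * conj (y k) * faberGram g r c 1 j k = A :=
    sum_mul_integral_mul_conj (fun j _ k _ => hg.integrableOn_enclosedSet le_rfl
      ((Polynomial.continuous _).mul (continuous_conj.comp (Polynomial.continuous _)))) y
  have hdiag : ((∑ k ∈ s, ‖x k‖ ^ 2 : ℝ) : ℂ) =
      ∑ j ∈ s, ∑ k ∈ s, conj (x j) * x k * if j = k then 1 else 0 := by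
    simp only [mul_ite, mul_one, mul_zero, Finset.sum_ite_eq, ofReal_sum, ofReal_pow]
    exact Finset.sum_congr rfl fun j hj => by rw [if_pos hj, conj_mul']
  have hsub : ((∑ k ∈ s, ‖x k‖ ^ 2 - ‖∑ k ∈ s, x k • hg.grunskyRow k‖ ^ 2 : ℝ) : ℂ) =
      ((π⁻¹ * A : ℝ) : ℂ) := by
    rw [ofReal_sub, ofReal_norm_sq_sum_smul, hdiag, ofReal_mul, ofReal_inv, ← hgram,
      Finset.mul_sum, ← Finset.sum_sub_distrib]
    refine Finset.sum_congr rfl fun j _ => ?_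
    rw [Finset.mul_sum, ← Finset.sum_sub_distrib]
    refine Finset.sum_congr rfl fun k _ => ?_
    simp only [hg.faberGram_one_eq_inner, y, map_div₀, conj_ofReal, Complex.conj_conj]
    have hπ : (π : ℂ) ≠ 0 := ofReal_ne_zero.2 Real.pi_ne_zero
    have hj := hsqrt j
    have hk := hsqrt k
    field_simp
  have hA : 0 ≤ A := integral_nonneg fun w => by positivity
  exact sub_nonneg.1 (ofReal_injective hsub ▸ mul_nonneg (inv_nonneg.2 Real.pi_pos.le) hA)

theorem faberGram_one_eq_smul (hg : IsUnivalentAtInfinity g r c) {C : EllTwo →L[ℂ] EllTwo}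
    (hC : ∀ k, C (ellBasis k) = hg.grunskyRow k) (n : ℕ) :
    (Matrix.of fun i j : Fin n => faberGram g r c 1 (i + 1) (j + 1)) =
      (π : ℂ) • (Matrix.diagonal (fun i : Fin n => (√((i + 1 : ℕ) : ℝ) : ℂ)) *
        (1 - truncGram n C) * Matrix.diagonal fun i : Fin n => (√((i + 1 : ℕ) : ℝ) : ℂ)) := by
  ext i j
  have h := hg.faberGram_one_eq_inner (i : ℕ).succPNat (j : ℕ).succPNat
  simp only [Nat.succPNat_inj, Fin.val_inj, Nat.succPNat_coe, Nat.succ_eq_add_one] at h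
  rw [Matrix.smul_apply, Matrix.mul_diagonal, Matrix.diagonal_mul, Matrix.sub_apply,
    Matrix.one_apply, truncGram, Matrix.of_apply, Matrix.of_apply, hC, hC, h, smul_eq_mul]

theorem exists_isGrunskyOperator (hg : IsUnivalentAtInfinity g r c) :
    ∃ B : EllTwo →L[ℂ] EllTwo, IsGrunskyOperator (grunskyCoeff r c) B ∧ ∀ n : ℕ,
      (Matrix.of fun i j : Fin n => faberGram g r c 1 (i + 1) (j + 1)).det =
        π ^ n * n.factorial * truncDet n B := by
  obtain ⟨C, hC⟩ := exists_clm_apply_ellBasis hg.norm_sum_grunskyRow_le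
  refine ⟨ContinuousLinearMap.adjoint C, fun k l => ?_, fun n => ?_⟩
  · rw [← inner_ellBasis, ContinuousLinearMap.adjoint_inner_right, hC, ellBasis,
      lp.inner_single_right, grunskyRow_apply]
    simp
  · have hprod : (∏ i : Fin n, (√((i + 1 : ℕ) : ℝ) : ℂ)) * ∏ i : Fin n, (√((i + 1 : ℕ) : ℝ) : ℂ) =
        n.factorial := by
      simp only [← Finset.prod_mul_distrib, sqrt_natCast_mul_self]
      rw [← Nat.cast_prod, ← Finset.prod_range fun i => i + 1,
        Finset.prod_range_add_one_eq_factorial]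
    rw [hg.faberGram_one_eq_smul hC, Matrix.det_smul, Matrix.det_mul, Matrix.det_mul,
      Matrix.det_diagonal, truncDet_adjoint, Fintype.card_fin, ← hprod]
    ring

end IsUnivalentAtInfinity

end GrunskyOperator

/-! ### Coulomb gas and moments -/

section Andreief

variable {ι α 𝕜 : Type*} [Fintype ι] [RCLike 𝕜] {mα : MeasurableSpace α}
  {μ : Measure α} [SigmaFinite μ] {φ ψ : ι → α → 𝕜}

theorem integrable_prod_perm (h : ∀ i j, Integrable (fun x => φ i x * ψ j x) μ)
    (σ τ : Equiv.Perm ι) :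
    Integrable (fun z : ι → α => ∏ k, φ (σ k) (z k) * ψ (τ k) (z k)) (.pi fun _ => μ) :=
  Integrable.fintype_prod (f := fun k x => φ (σ k) x * ψ (τ k) x) fun k => h (σ k) (τ k)

variable [DecidableEq ι]

theorem det_mul_det_eq_sum {R : Type*} [CommRing R] (A B : Matrix ι ι R) :
    A.det * B.det = ∑ σ : Equiv.Perm ι, ∑ τ : Equiv.Perm ι,
      ((Equiv.Perm.sign σ : ℤ) : R) * ((Equiv.Perm.sign τ : ℤ) : R) *
        ∏ k, A (σ k) k * B (τ k) k := by
  rw [Matrix.det_apply', Matrix.det_apply', Finset.sum_mul_sum]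
  simp only [Finset.prod_mul_distrib, mul_mul_mul_comm]

theorem integrable_det_mul_det (h : ∀ i j, Integrable (fun x => φ i x * ψ j x) μ) :
    Integrable (fun z : ι → α =>
      (Matrix.of fun i k => φ i (z k)).det * (Matrix.of fun i k => ψ i (z k)).det)
      (.pi fun _ => μ) := by
  simp only [det_mul_det_eq_sum, Matrix.of_apply]
  exact integrable_finsetSum _ fun σ _ => integrable_finsetSum _ fun τ _ =>
    (integrable_prod_perm h σ τ).const_mul _

/-- Andréief's identity. -/
theorem integral_det_mul_det (h : ∀ i j, Integrable (fun x => φ i x * ψ j x) μ) :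
    ∫ z : ι → α, (Matrix.of fun i k => φ i (z k)).det * (Matrix.of fun i k => ψ i (z k)).det
      ∂(.pi fun _ => μ) =
      (Fintype.card ι).factorial * (Matrix.of fun i j => ∫ x, φ i x * ψ j x ∂μ).det := by
  let H : Matrix ι ι 𝕜 := .of fun i j => ∫ x, φ i x * ψ j x ∂μ
  have hinteg := integrable_prod_perm h
  have hperm : ∀ σ : Equiv.Perm ι, ∑ τ : Equiv.Perm ι,
      ((Equiv.Perm.sign σ : ℤ) : 𝕜) * ((Equiv.Perm.sign τ : ℤ) : 𝕜) * ∏ k, H (σ k) (τ k) =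
        H.det := fun σ => by
    have hsign : ((Equiv.Perm.sign σ : ℤ) : 𝕜) * (H.submatrix σ id).transpose.det = H.det := by
      rw [Matrix.det_transpose, Matrix.det_permute, ← mul_assoc, ← Int.cast_mul,
        ← Units.val_mul, Int.units_mul_self, Units.val_one, Int.cast_one, one_mul]
    rw [← hsign, Matrix.det_apply', Finset.mul_sum]
    simp only [mul_assoc, Matrix.transpose_apply, Matrix.submatrix_apply, id_eq]
  simp only [det_mul_det_eq_sum, Matrix.of_apply]
  calc
    _ = ∑ σ : Equiv.Perm ι, ∑ τ : Equiv.Perm ι,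
        ((Equiv.Perm.sign σ : ℤ) : 𝕜) * ((Equiv.Perm.sign τ : ℤ) : 𝕜) * ∏ k, H (σ k) (τ k) := by
      rw [integral_finsetSum _ fun σ _ => integrable_finsetSum _ fun τ _ =>
        (hinteg σ τ).const_mul _]
      refine Finset.sum_congr rfl fun σ _ => ?_
      rw [integral_finsetSum _ fun τ _ => (hinteg σ τ).const_mul _]
      refine Finset.sum_congr rfl fun τ _ => ?_
      rw [integral_const_mul, integral_fintype_prod_eq_prod
        (f := fun k x => φ (σ k) x * ψ (τ k) x)]
      rfl
    _ = (Fintype.card ι).factorial * H.det := by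
      rw [Finset.sum_congr rfl fun σ _ => hperm σ, Finset.sum_const, Finset.card_univ,
        Fintype.card_perm, nsmul_eq_mul]

end Andreief

section CoulombGas

variable {n : ℕ} {Ω : Set ℂ} {φ : Fin n → ℂ → ℂ}

theorem configSpace_eq_pi (n : ℕ) (Ω : Set ℂ) : configSpace n Ω = univ.pi fun _ => Ω := by
  ext z
  simp [configSpace]

theorem restrict_configSpace (n : ℕ) (Ω : Set ℂ) :
    volume.restrict (configSpace n Ω) = Measure.pi fun _ => volume.restrict Ω := by
  rw [configSpace_eq_pi, volume_pi, Measure.restrict_pi_pi]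

theorem ofReal_norm_det_sq {ι : Type*} [Fintype ι] [DecidableEq ι] (A : Matrix ι ι ℂ) :
    ((‖A.det‖ ^ 2 : ℝ) : ℂ) = A.det * (A.map conj).det := by
  rw [ofReal_pow, ← mul_conj', RingHom.map_det, RingHom.mapMatrix_apply]

theorem integrableOn_norm_det_sq (h : ∀ i j, IntegrableOn (fun w => φ i w * conj (φ j w)) Ω) :
    IntegrableOn (fun z : Fin n → ℂ => ‖(Matrix.of fun i k => φ i (z k)).det‖ ^ 2)
      (configSpace n Ω) := by
  rw [IntegrableOn, restrict_configSpace]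
  refine (integrable_det_mul_det h).re.congr (Eventually.of_forall fun z => ?_)
  exact congrArg re (ofReal_norm_det_sq (Matrix.of fun i k => φ i (z k))).symm

theorem integral_norm_det_sq (h : ∀ i j, IntegrableOn (fun w => φ i w * conj (φ j w)) Ω) :
    ((∫ z in configSpace n Ω, ‖(Matrix.of fun i k => φ i (z k)).det‖ ^ 2 : ℝ) : ℂ) =
      n.factorial * (Matrix.of fun i j => ∫ w in Ω, φ i w * conj (φ j w)).det := by
  rw [← integral_complex_ofReal, restrict_configSpace]
  simp only [ofReal_norm_det_sq]
  exact (integral_det_mul_det h).trans (by rw [Fintype.card_fin])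

theorem coulombWeight_eq (z : Fin n → ℂ) :
    coulombWeight n z = ‖(Matrix.of fun j k : Fin n => z k ^ (j : ℕ)).det‖ ^ 2 := by
  change _ = ‖(Matrix.vandermonde z).transpose.det‖ ^ 2
  rw [Matrix.det_transpose, Matrix.det_vandermonde]
  simp only [norm_prod, ← Finset.prod_pow, coulombWeight, norm_sub_rev]

/-- The matrix of the moments `∫ w ^ i * conj (w ^ j)` of a plane set. -/
noncomputable def momentMatrix (n : ℕ) (Ω : Set ℂ) : Matrix (Fin n) (Fin n) ℂ :=
  .of fun i j => ∫ w in Ω, w ^ (i : ℕ) * conj (w ^ (j : ℕ))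

theorem integrableOn_moment (hΩ : Bornology.IsBounded Ω) (i j : ℕ) :
    IntegrableOn (fun w : ℂ => w ^ i * conj (w ^ j)) Ω := by
  have hcont : Continuous fun w : ℂ => w ^ i * conj (w ^ j) := by fun_prop
  exact (hcont.continuousOn.integrableOn_compact hΩ.isCompact_closure).mono_set subset_closure

theorem integrableOn_coulombWeight (n : ℕ) (hΩ : Bornology.IsBounded Ω) :
    IntegrableOn (coulombWeight n) (configSpace n Ω) := by
  simpa only [← coulombWeight_eq] using integrableOn_norm_det_sq
    (φ := fun (j : Fin n) w => w ^ (j : ℕ)) fun i j => integrableOn_moment hΩ i j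

theorem partitionFn_eq_det (n : ℕ) (hΩ : Bornology.IsBounded Ω) :
    (partitionFn n Ω : ℂ) = (momentMatrix n Ω).det := by
  have h := integral_norm_det_sq (φ := fun (j : Fin n) w => w ^ (j : ℕ))
    fun i j => integrableOn_moment hΩ i j
  simp only [← coulombWeight_eq] at h
  rw [partitionFn, ofReal_mul, h, ofReal_div, ofReal_one, ofReal_natCast, ← mul_assoc,
    one_div_mul_cancel (Nat.cast_ne_zero.2 n.factorial_ne_zero), one_mul, momentMatrix]

theorem partitionFn_pos (n : ℕ) (hΩ : Bornology.IsBounded Ω) (ho : IsOpen Ω)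
    (hne : Ω.Nonempty) : 0 < partitionFn n Ω := by
  have hcont : Continuous (coulombWeight n) := by
    unfold coulombWeight
    fun_prop
  have hopen : IsOpen (configSpace n Ω) := by
    rw [configSpace_eq_pi]
    exact isOpen_set_pi finite_univ fun _ _ => ho
  have hnonneg : ∀ z, 0 ≤ coulombWeight n z := fun z => by
    rw [coulombWeight_eq]
    positivity
  refine mul_pos (by positivity) ((setIntegral_pos_iff_support_of_nonneg_ae
    (Eventually.of_forall hnonneg) (integrableOn_coulombWeight n hΩ)).2
    ((hcont.isOpen_support.inter hopen).measure_pos _ ?_))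
  have hinf : Ω.Infinite := hne.elim fun w hw => infinite_of_mem_nhds w (ho.mem_nhds hw)
  let e := hinf.natEmbedding
  refine ⟨fun k : Fin n => (e k : ℂ), ?_, fun k => (e k).2⟩
  refine Finset.prod_ne_zero_iff.2 fun k _ => Finset.prod_ne_zero_iff.2 fun l hl => ?_
  refine pow_ne_zero _ (norm_ne_zero_iff.2 (sub_ne_zero.2 fun heq => ?_))
  exact (Finset.mem_Ioi.1 hl).ne (Fin.val_injective (e.injective (Subtype.ext heq)))

/-- The matrix whose rows are the coefficients, in degrees less than `n`, of `n` polynomials. -/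
noncomputable def coeffMatrix {n : ℕ} (p : Fin n → Polynomial ℂ) : Matrix (Fin n) (Fin n) ℂ :=
  .of fun i a => (p i).coeff a

theorem gram_eq_coeffMatrix_mul (hΩ : Bornology.IsBounded Ω) {p : Fin n → Polynomial ℂ}
    (hp : ∀ i, (p i).natDegree < n) :
    (Matrix.of fun i j => ∫ w in Ω, (p i).eval w * conj ((p j).eval w)) =
      coeffMatrix p * momentMatrix n Ω * (coeffMatrix p).conjTranspose := by
  have hexpand : ∀ i j (w : ℂ), (p i).eval w * conj ((p j).eval w) =
      ∑ b : Fin n, ∑ a : Fin n, (p i).coeff a * conj ((p j).coeff b) *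
        (w ^ (a : ℕ) * conj (w ^ (b : ℕ))) := fun i j w => by
    rw [Polynomial.eval_eq_sum_range' (hp i), Polynomial.eval_eq_sum_range' (hp j),
      Finset.sum_range, Finset.sum_range, map_sum, Finset.sum_mul_sum, Finset.sum_comm]
    simp only [map_mul, mul_mul_mul_comm]
  have hinteg := fun (i j a b : Fin n) => (integrableOn_moment hΩ a b).const_mul
    ((p i).coeff a * conj ((p j).coeff b))
  ext i j
  simp only [Matrix.of_apply, hexpand, Matrix.mul_apply, Finset.sum_mul]
  rw [integral_finsetSum _ fun b _ => integrable_finsetSum _ fun a _ => hinteg i j a b]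
  refine Finset.sum_congr rfl fun b _ => ?_
  rw [integral_finsetSum _ fun a _ => hinteg i j a b]
  refine Finset.sum_congr rfl fun a _ => ?_
  rw [integral_const_mul, Matrix.conjTranspose_apply, coeffMatrix, momentMatrix, Matrix.of_apply,
    Matrix.of_apply, Matrix.of_apply, RCLike.star_def, mul_right_comm]

theorem prod_pow_succ_sq {R : Type*} [CommMonoid R] (x : R) (n : ℕ) :
    (∏ i : Fin n, x ^ ((i : ℕ) + 1)) ^ 2 = x ^ (n * (n + 1)) := by
  rw [← Finset.prod_range fun i => x ^ (i + 1)]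
  induction n with
  | zero => simp
  | succ k ih =>
    rw [Finset.prod_range_succ, mul_pow, ih, ← pow_mul, ← pow_add]
    ring_nf

theorem det_coeffMatrix_faber (r : ℂ) (c : ℕ → ℂ) (n : ℕ) :
    (coeffMatrix fun i : Fin n => (faber r c (i + 1)).derivative).det =
      n.factorial * ∏ i : Fin n, r⁻¹ ^ ((i : ℕ) + 1) := by
  rw [Matrix.det_of_isLowerTriangular]
  · rw [← Finset.prod_range_add_one_eq_factorial, Nat.cast_prod, Finset.prod_range,
      ← Finset.prod_mul_distrib]
    refine Finset.prod_congr rfl fun i _ => ?_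
    rw [coeffMatrix, Matrix.of_apply, Polynomial.coeff_derivative, coeff_faber_self, mul_comm,
      Nat.cast_add_one]
  · intro i j hij
    have hij' : (i : ℕ) < j := hij
    rw [coeffMatrix, Matrix.of_apply, Polynomial.coeff_derivative,
      Polynomial.coeff_eq_zero_of_natDegree_lt, zero_mul]
    exact (natDegree_faber_le _).trans_lt (by omega)

variable {g : ℂ → ℂ} {r : ℂ} {c : ℕ → ℂ}

theorem HasExpansionAtInfinity.det_faberGram_one (hg : HasExpansionAtInfinity g r c) (n : ℕ) :
    (Matrix.of fun i j : Fin n => faberGram g r c 1 (i + 1) (j + 1)).det =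
      (n.factorial : ℂ) ^ 2 * (‖r‖ : ℂ)⁻¹ ^ (n * (n + 1)) *
        (momentMatrix n (enclosedSet g 1)).det := by
  have hdeg : ∀ i : Fin n, (faber r c (i + 1)).derivative.natDegree < n := fun i =>
    ((Polynomial.natDegree_derivative_le _).trans
      (Nat.sub_le_sub_right (natDegree_faber_le _) 1)).trans_lt (by omega)
  have hnorm : (∏ i : Fin n, r⁻¹ ^ ((i : ℕ) + 1)) * conj (∏ i : Fin n, r⁻¹ ^ ((i : ℕ) + 1)) =
      (‖r‖ : ℂ)⁻¹ ^ (n * (n + 1)) := by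
    rw [mul_conj', norm_prod, ← prod_pow_succ_sq]
    simp only [norm_pow, norm_inv, ofReal_prod, ofReal_pow, ofReal_inv]
  refine (congrArg Matrix.det
    (gram_eq_coeffMatrix_mul (hg.isBounded_enclosedSet le_rfl) hdeg)).trans ?_
  rw [Matrix.det_mul, Matrix.det_mul, Matrix.det_conjTranspose, det_coeffMatrix_faber, ← hnorm,
    RCLike.star_def, map_mul, map_natCast]
  ring

namespace IsUnivalentAtInfinity

theorem exists_truncDet_eq_partitionFn (hg : IsUnivalentAtInfinity g r c) {D : Set ℂ}
    (hsub : D ⊆ enclosedSet g 1) (hnull : volume (enclosedSet g 1 \ D) = 0) :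
    ∃ B : EllTwo →L[ℂ] EllTwo, IsGrunskyOperator (grunskyCoeff r c) B ∧ ∀ n : ℕ,
      truncDet n B =
        ((n.factorial / π ^ n * ‖r‖⁻¹ ^ (n * (n + 1)) * partitionFn n D : ℝ) : ℂ) := by
  obtain ⟨B, hB, hdet⟩ := hg.exists_isGrunskyOperator
  refine ⟨B, hB, fun n => ?_⟩
  have hbdd := (hg.isBounded_enclosedSet le_rfl).subset hsub
  have hmoment : momentMatrix n (enclosedSet g 1) = momentMatrix n D := Matrix.ext fun i j =>
    setIntegral_congr_set ((ae_le_set.2 hnull).antisymm hsub.eventuallyLE)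
  have h := hdet n
  rw [hg.det_faberGram_one, hmoment, ← partitionFn_eq_det n hbdd] at h
  have hπ : (π : ℂ) ≠ 0 := ofReal_ne_zero.2 Real.pi_ne_zero
  have hfact : (n.factorial : ℂ) ≠ 0 := Nat.cast_ne_zero.2 n.factorial_ne_zero
  refine mul_left_cancel₀ (mul_ne_zero (pow_ne_zero n hπ) hfact) (h.symm.trans ?_)
  push_cast
  field_simp

theorem exists_log_partitionFn (hg : IsUnivalentAtInfinity g r c) {D : Set ℂ} (hDo : IsOpen D)
    (hDne : D.Nonempty) (hsub : D ⊆ enclosedSet g 1)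
    (hnull : volume (enclosedSet g 1 \ D) = 0) :
    ∃ B : EllTwo →L[ℂ] EllTwo, IsGrunskyOperator (grunskyCoeff r c) B ∧ ∀ n : ℕ,
      0 < partitionFn n D ∧ (truncDet n B).im = 0 ∧ 0 < (truncDet n B).re ∧
      Real.log (partitionFn n D) = Real.log (π ^ n / n.factorial) +
        n * (n + 1) * Real.log ‖r‖ + Real.log (truncDet n B).re := by
  obtain ⟨B, hB, hdet⟩ := hg.exists_truncDet_eq_partitionFn hsub hnull
  refine ⟨B, hB, fun n => ?_⟩
  have hZ := partitionFn_pos n ((hg.isBounded_enclosedSet le_rfl).subset hsub) hDo hDne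
  have hr : 0 < ‖r‖ := norm_pos_iff.2 hg.ne_zero
  have hfact : (0 : ℝ) < n.factorial := Nat.cast_pos.2 n.factorial_pos
  have hπ : (0 : ℝ) < π ^ n := pow_pos Real.pi_pos n
  rw [hdet n, ofReal_im, ofReal_re]
  refine ⟨hZ, rfl, by positivity, ?_⟩
  rw [Real.log_mul (by positivity) hZ.ne', Real.log_mul (by positivity) (by positivity),
    Real.log_div hπ.ne' hfact.ne', Real.log_div hfact.ne' hπ.ne']
  simp only [Real.log_pow, Real.log_inv]
  push_cast
  ring

end IsUnivalentAtInfinity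

end CoulombGas

/-! ### Inversion -/

section Inversion

open scoped Pointwise

variable {n : ℕ} {Ω s : Set ℂ}

theorem exp_neg_mul_sum_log {z : Fin n → ℂ} (hz : ∀ k, z k ≠ 0) :
    Real.exp (-((n : ℝ) + 1) * ∑ k, Real.log (‖z k‖ ^ 2)) =
      (‖∏ k, z k ^ (n + 1)‖ ^ 2)⁻¹ := by
  have hz2 : ∀ k, 0 < ‖z k‖ ^ 2 := fun k => pow_pos (norm_pos_iff.2 (hz k)) 2
  rw [neg_mul, Real.exp_neg, ← Real.log_prod fun k _ => (hz2 k).ne', ← Nat.cast_add_one,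
    ← Real.log_pow, Real.exp_log (pow_pos (Finset.prod_pos fun k _ => hz2 k) _),
    Finset.prod_pow, Finset.prod_pow, norm_pow, norm_prod, pow_right_comm]

theorem exteriorCoulombWeight_eq {z : Fin n → ℂ} (hz : ∀ k, z k ≠ 0) :
    exteriorCoulombWeight n z =
      ‖(Matrix.of fun j k : Fin n => (z k)⁻¹ ^ (j : ℕ) * (z k)⁻¹ ^ 2).det‖ ^ 2 := by
  let A : Matrix (Fin n) (Fin n) ℂ := .of fun j k => (z k)⁻¹ ^ (j : ℕ) * (z k)⁻¹ ^ 2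
  have hfactor : Matrix.projVandermonde 1 z =
      .of fun k j => z k ^ (n + 1) * A.transpose k j := by
    ext k j
    have hexp : n + 1 = (j.rev : ℕ) + (j + 2) := by
      rw [Fin.val_rev]
      omega
    rw [Matrix.projVandermonde_apply, Pi.one_apply, one_pow, one_mul]
    change z k ^ (j.rev : ℕ) = z k ^ (n + 1) * ((z k)⁻¹ ^ (j : ℕ) * (z k)⁻¹ ^ 2)
    rw [← pow_add, hexp, pow_add, mul_assoc, ← mul_pow, mul_inv_cancel₀ (hz k), one_pow, mul_one]
  have hweight : coulombWeight n z = ‖∏ k, z k ^ (n + 1)‖ ^ 2 * ‖A.det‖ ^ 2 := by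
    rw [← mul_pow, ← norm_mul, ← A.det_transpose, ← Matrix.det_mul_column, ← hfactor,
      Matrix.det_projVandermonde]
    simp only [norm_prod, ← Finset.prod_pow, coulombWeight, Pi.one_apply, one_mul]
  have hprod : (∏ k, z k ^ (n + 1)) ≠ 0 :=
    Finset.prod_ne_zero_iff.2 fun k _ => pow_ne_zero _ (hz k)
  rw [exteriorCoulombWeight, exp_neg_mul_sum_log hz, hweight,
    inv_mul_cancel_left₀ (pow_ne_zero 2 (norm_ne_zero_iff.2 hprod))]

theorem inv_moment_eq_jacobian_mul (z : ℂ) (i j : ℕ) :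
    z⁻¹ ^ i * z⁻¹ ^ 2 * conj (z⁻¹ ^ j * z⁻¹ ^ 2) =
      (‖-(z ^ 2)⁻¹‖ : ℂ) ^ 2 * (z⁻¹ ^ i * conj (z⁻¹ ^ j)) := by
  rw [norm_neg, ← inv_pow, ← mul_conj', map_mul]
  ring

theorem integrableOn_inv_moment (hΩ : MeasurableSet Ω) (h0 : (0 : ℂ) ∉ Ω)
    (hb : Bornology.IsBounded Ω⁻¹) (i j : ℕ) :
    IntegrableOn (fun z : ℂ => z⁻¹ ^ i * z⁻¹ ^ 2 * conj (z⁻¹ ^ j * z⁻¹ ^ 2)) Ω := by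
  have h := integrableOn_moment hb i j
  rw [← image_inv_eq_inv, integrableOn_image_of_hasDerivAt hΩ
    (fun z hz => hasDerivAt_inv (ne_of_mem_of_not_mem hz h0)) inv_injective.injOn] at h
  simpa only [inv_moment_eq_jacobian_mul] using h

theorem integral_inv_moment (hΩ : MeasurableSet Ω) (h0 : (0 : ℂ) ∉ Ω) (i j : ℕ) :
    ∫ z in Ω, z⁻¹ ^ i * z⁻¹ ^ 2 * conj (z⁻¹ ^ j * z⁻¹ ^ 2) = ∫ w in Ω⁻¹, w ^ i * conj (w ^ j) := by
  rw [← image_inv_eq_inv, integral_image_of_hasDerivAt hΩ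
    (fun z hz => hasDerivAt_inv (ne_of_mem_of_not_mem hz h0)) inv_injective.injOn]
  simp only [inv_moment_eq_jacobian_mul]

theorem eqOn_exteriorCoulombWeight (h0 : (0 : ℂ) ∉ Ω) :
    EqOn (fun z => ‖(Matrix.of fun j k : Fin n => (z k)⁻¹ ^ (j : ℕ) * (z k)⁻¹ ^ 2).det‖ ^ 2)
      (exteriorCoulombWeight n) (configSpace n Ω) := fun _ hz =>
  (exteriorCoulombWeight_eq fun k => ne_of_mem_of_not_mem (hz k) h0).symm

theorem measurableSet_configSpace (n : ℕ) (hΩ : MeasurableSet Ω) :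
    MeasurableSet (configSpace n Ω) := by
  rw [configSpace_eq_pi]
  exact .univ_pi fun _ => hΩ

theorem integrableOn_exteriorCoulombWeight (n : ℕ) (hΩ : MeasurableSet Ω) (h0 : (0 : ℂ) ∉ Ω)
    (hb : Bornology.IsBounded Ω⁻¹) :
    IntegrableOn (exteriorCoulombWeight n) (configSpace n Ω) :=
  (integrableOn_norm_det_sq (φ := fun (j : Fin n) z => z⁻¹ ^ (j : ℕ) * z⁻¹ ^ 2)
    fun i j => integrableOn_inv_moment hΩ h0 hb i j).congr_fun
      (eqOn_exteriorCoulombWeight h0) (measurableSet_configSpace n hΩ)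

theorem exteriorPartitionFn_eq (n : ℕ) (hΩ : MeasurableSet Ω) (h0 : (0 : ℂ) ∉ Ω)
    (hb : Bornology.IsBounded Ω⁻¹) : exteriorPartitionFn n Ω = partitionFn n Ω⁻¹ := by
  have h := integral_norm_det_sq (φ := fun (j : Fin n) z => z⁻¹ ^ (j : ℕ) * z⁻¹ ^ 2)
    fun i j => integrableOn_inv_moment hΩ h0 hb i j
  rw [setIntegral_congr_fun (measurableSet_configSpace n hΩ) (eqOn_exteriorCoulombWeight h0)] at h
  simp only [integral_inv_moment hΩ h0] at h
  refine ofReal_injective ?_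
  rw [partitionFn_eq_det n hb, exteriorPartitionFn, ofReal_mul, h, ofReal_div, ofReal_one,
    ofReal_natCast, ← mul_assoc, one_div_mul_cancel (Nat.cast_ne_zero.2 n.factorial_ne_zero),
    one_mul, momentMatrix]

theorem isOpen_inv_of_zero_notMem (hΩ : IsOpen Ω) (h0 : (0 : ℂ) ∉ Ω) : IsOpen Ω⁻¹ := by
  have hΩ0 : Ω⁻¹ ⊆ {0}ᶜ := fun w hw hw0 => by
    rw [mem_singleton_iff.1 hw0, Set.mem_inv, inv_zero] at hw
    exact h0 hw
  rw [← inter_eq_right.2 hΩ0]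
  exact continuousOn_inv₀.isOpen_inter_preimage isOpen_compl_singleton hΩ

theorem volume_inv_eq_zero (h0 : (0 : ℂ) ∉ s) (hs : volume s = 0) : volume s⁻¹ = 0 := by
  rw [← image_inv_eq_inv]
  refine addHaar_image_eq_zero_of_differentiableOn_of_addHaar_eq_zero _ (fun z hz => ?_) hs
  exact ((differentiableAt_inv (𝕜 := ℂ)
    (ne_of_mem_of_not_mem hz h0)).restrictScalars ℝ).differentiableWithinAt

end Inversion

section InteriorCoefficients

theorem exists_log_of_differentiableOn_ball {q : ℂ → ℂ} {a : ℂ} {R : ℝ}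
    (hq : DifferentiableOn ℂ q (ball a R)) (hne : ∀ v ∈ ball a R, q v ≠ 0) {ℓ : ℂ}
    (hℓ : cexp ℓ = q a) :
    ∃ Λ : ℂ → ℂ, DifferentiableOn ℂ Λ (ball a R) ∧ Λ a = ℓ ∧ ∀ v ∈ ball a R, cexp (Λ v) = q v := by
  obtain ⟨Λ, hΛa, hΛ⟩ := ((hq.deriv isOpen_ball).div hq hne).isExactOn_ball.with_val_at a ℓ
  refine ⟨Λ, fun v hv => (hΛ v hv).differentiableAt.differentiableWithinAt, hΛa, fun v hv => ?_⟩
  have hderiv : ∀ u ∈ ball a R, HasDerivAt q (q u * (deriv q u / q u)) u := fun u hu => by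
    rw [mul_div_cancel₀ _ (hne u hu)]
    exact (hq.differentiableAt (isOpen_ball.mem_nhds hu)).hasDerivAt
  rw [eq_mul_exp_sub_of_hasDerivAt isOpen_ball (convex_ball a R).isPreconnected hderiv hΛ hv
    (mem_ball_self (pos_of_mem_ball hv)), hΛa, ← hℓ, ← Complex.exp_add, add_sub_cancel]

variable {r : ℂ} {c t : ℕ → ℂ}

/-- The interior Grunsky coefficients of `f`, in terms of the coefficients `r`, `c` of
`z ↦ 1 / f (1 / z)` at infinity and of the Taylor coefficients `t` of `log (f ζ / ζ)`. -/
noncomputable def interiorCoeff (r : ℂ) (c t : ℕ → ℂ) (k l : ℕ) : ℂ :=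
  if l = 0 then -t k else if k = 0 then -t l else grunskyCoeff r c k.toPNat' l.toPNat'

theorem interiorCoeff_zero_zero : interiorCoeff r c t 0 0 = -t 0 := if_pos rfl

theorem interiorCoeff_pnat (k l : ℕ+) : interiorCoeff r c t k l = grunskyCoeff r c k l := by
  simp [interiorCoeff]

theorem hasSum_interiorCoeff {ζ z L Λ₁ Λ₂ : ℂ}
    (hL : HasSum (fun p : ℕ+ × ℕ+ =>
      -(grunskyCoeff r c p.1 p.2 * ζ ^ (p.1 : ℕ) * z ^ (p.2 : ℕ))) L)
    (h₁ : HasSum (fun k => t k * ζ ^ k) Λ₁) (h₂ : HasSum (fun l => t l * z ^ l) Λ₂) :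
    HasSum (fun p : ℕ × ℕ => -(interiorCoeff r c t p.1 p.2 * ζ ^ p.1 * z ^ p.2))
      (L + Λ₁ + Λ₂ - t 0) := by
  have hpos : HasSum (fun p : ℕ × ℕ => if p.1 ≠ 0 ∧ p.2 ≠ 0 then
      -(grunskyCoeff r c p.1.toPNat' p.2.toPNat' * ζ ^ p.1 * z ^ p.2) else 0) L := by
    have hinj : Function.Injective fun p : ℕ+ × ℕ+ => ((p.1 : ℕ), (p.2 : ℕ)) :=
      PNat.coe_injective.prodMap PNat.coe_injective
    refine (hinj.hasSum_iff fun p hp => if_neg fun h => hp ?_).1 (hL.congr_fun fun p => by simp)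
    exact ⟨(⟨p.1, Nat.pos_of_ne_zero h.1⟩, ⟨p.2, Nat.pos_of_ne_zero h.2⟩), rfl⟩
  have hleft : HasSum (fun p : ℕ × ℕ => if p.2 = 0 then t p.1 * ζ ^ p.1 else 0) Λ₁ := by
    have hinj : Function.Injective fun k : ℕ => (k, 0) := Prod.mk_left_injective 0
    exact (hinj.hasSum_iff fun p hp => if_neg fun h => hp ⟨p.1, Prod.ext rfl h.symm⟩).1
      (h₁.congr_fun fun k => by simp)
  have hright : HasSum (fun p : ℕ × ℕ => if p.1 = 0 then t p.2 * z ^ p.2 else 0) Λ₂ := by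
    have hinj : Function.Injective fun l : ℕ => (0, l) := Prod.mk_right_injective 0
    exact (hinj.hasSum_iff fun p hp => if_neg fun h => hp ⟨p.2, Prod.ext h.symm rfl⟩).1
      (h₂.congr_fun fun l => by simp)
  have hzero : HasSum (fun p : ℕ × ℕ => if p = (0, 0) then t 0 else 0) (t 0) := hasSum_ite_eq _ _
  refine (((hpos.add hleft).add hright).sub hzero).congr_fun fun ⟨k, l⟩ => ?_
  by_cases hk : k = 0 <;> by_cases hl : l = 0 <;> simp [interiorCoeff, hk, hl]

end InteriorCoefficients

end Grunsky

namespace IsExteriorConformalMap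

open Grunsky Complex Set

variable {D : Set ℂ} {g : ℂ → ℂ} {r : ℝ}

theorem exists_isUnivalentAtInfinity (hg : IsExteriorConformalMap D g r) :
    ∃ c : ℕ → ℂ, IsUnivalentAtInfinity g r c := by
  obtain ⟨c, hc⟩ := hg.expansion
  exact ⟨c, ⟨hc, ofReal_ne_zero.2 hg.pos.ne'⟩, hg.injOn⟩

theorem enclosedSet_eq (hg : IsExteriorConformalMap D g r) : enclosedSet g 1 = closure D := by
  rw [enclosedSet, hg.image_eq, exteriorDomain, compl_compl]

theorem exists_log_partitionFn (hg : IsExteriorConformalMap D g r) (hDo : IsOpen D)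
    (hDne : D.Nonempty) (hnull : volume (frontier D) = 0) :
    ∃ (a : ℕ+ → ℕ+ → ℂ) (B : EllTwo →L[ℂ] EllTwo),
      IsExteriorGrunskyCoeff g r a ∧ IsGrunskyOperator a B ∧
      ∀ n : ℕ, IntegrableOn (coulombWeight n) (configSpace n D) ∧
        0 < partitionFn n D ∧ (truncDet n B).im = 0 ∧ 0 < (truncDet n B).re ∧
        Real.log (partitionFn n D) = Real.log (Real.pi ^ n / n.factorial) +
          n * (n + 1) * Real.log r + Real.log (truncDet n B).re := by
  obtain ⟨c, hu⟩ := hg.exists_isUnivalentAtInfinity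
  have hsub : D ⊆ enclosedSet g 1 := hg.enclosedSet_eq ▸ subset_closure
  have hb : Bornology.IsBounded D := (hu.isBounded_enclosedSet le_rfl).subset hsub
  obtain ⟨B, hB, hlog⟩ := hu.exists_log_partitionFn hDo hDne hsub
    (by rwa [hg.enclosedSet_eq, ← hDo.frontier_eq])
  simp only [norm_real, Real.norm_of_nonneg hg.pos.le] at hlog
  exact ⟨_, B, fun ζ z hζ hz hne => hu.exists_hasSum_grunskyCoeff hζ hz hne, hB,
    fun n => ⟨integrableOn_coulombWeight n hb, hlog n⟩⟩

end IsExteriorConformalMap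

namespace IsInteriorConformalMap

open Grunsky Complex Set Metric
open scoped Pointwise

variable {D : Set ℂ} {f : ℂ → ℂ} {r₀ : ℝ} {c : ℕ → ℂ} {v ζ z : ℂ}

theorem map_ne_zero (hf : IsInteriorConformalMap D f r₀) (hv : ‖v‖ < 1) (hv0 : v ≠ 0) :
    f v ≠ 0 := fun h =>
  hv0 (hf.injOn (mem_ball_zero_iff.2 hv) (mem_ball_self one_pos) (h.trans hf.map_zero.symm))

theorem ofReal_ne_zero (hf : IsInteriorConformalMap D f r₀) : (r₀ : ℂ) ≠ 0 :=
  Complex.ofReal_ne_zero.2 hf.pos.ne'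

theorem dslope_zero (hf : IsInteriorConformalMap D f r₀) : dslope f 0 0 = r₀ := by
  rw [dslope_same, hf.hasDerivAt_zero.deriv]

theorem dslope_eq_div (hf : IsInteriorConformalMap D f r₀) (hv0 : v ≠ 0) :
    dslope f 0 v = f v / v := by
  rw [dslope_of_ne _ hv0, slope_def_field, hf.map_zero, sub_zero, sub_zero]

theorem dslope_ne_zero (hf : IsInteriorConformalMap D f r₀) (hv : ‖v‖ < 1) :
    dslope f 0 v ≠ 0 := by
  rcases eq_or_ne v 0 with rfl | hv0
  · rw [hf.dslope_zero]
    exact hf.ofReal_ne_zero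
  · rw [hf.dslope_eq_div hv0]
    exact div_ne_zero (hf.map_ne_zero hv hv0) hv0

theorem differentiableOn_dslope (hf : IsInteriorConformalMap D f r₀) :
    DifferentiableOn ℂ (dslope f 0) (ball 0 1) :=
  (Complex.differentiableOn_dslope (ball_mem_nhds 0 one_pos)).2 hf.differentiableOn

theorem exists_isUnivalentAtInfinity (hf : IsInteriorConformalMap D f r₀) :
    ∃ c : ℕ → ℂ, IsUnivalentAtInfinity (fun z => (f z⁻¹)⁻¹) (r₀ : ℂ)⁻¹ c := by
  let h : ℂ → ℂ := fun v => (dslope f 0 v)⁻¹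
  have hh : DifferentiableOn ℂ (dslope h 0) (ball 0 1) :=
    (Complex.differentiableOn_dslope (ball_mem_nhds 0 one_pos)).2
      (hf.differentiableOn_dslope.inv fun v hv => hf.dslope_ne_zero (mem_ball_zero_iff.1 hv))
  refine ⟨fun n => iteratedDeriv n (dslope h 0) 0 / n.factorial,
    ⟨fun z hz => ?_, inv_ne_zero hf.ofReal_ne_zero⟩, fun z hz w hw hzw => ?_⟩
  · have hz0 := ne_zero_of_one_lt_norm hz
    have hvalue : dslope h 0 z⁻¹ = (f z⁻¹)⁻¹ - (r₀ : ℂ)⁻¹ * z := by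
      rw [dslope_of_ne _ (inv_ne_zero hz0), slope_def_field]
      simp only [h, hf.dslope_zero, hf.dslope_eq_div (inv_ne_zero hz0), sub_zero]
      field_simp
    exact hvalue ▸ hasSum_taylor_ball hh (norm_inv_lt_one hz)
  · exact inv_injective (hf.injOn (mem_ball_zero_iff.2 (norm_inv_lt_one hz))
      (mem_ball_zero_iff.2 (norm_inv_lt_one hw)) (inv_injective hzw))

theorem enclosedSet_eq (hf : IsInteriorConformalMap D f r₀) :
    enclosedSet (fun z => (f z⁻¹)⁻¹) 1 = (Dᶜ)⁻¹ ∪ {0} := by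
  have himage : (fun z => (f z⁻¹)⁻¹) '' {z | 1 < ‖z‖} = D⁻¹ \ {0} := by
    ext w
    rw [mem_sdiff_singleton, mem_inv, ← hf.image_eq]
    constructor
    · rintro ⟨z, hz, rfl⟩
      rw [inv_inv]
      exact ⟨⟨z⁻¹, mem_ball_zero_iff.2 (norm_inv_lt_one hz), rfl⟩, inv_ne_zero
        (hf.map_ne_zero (norm_inv_lt_one hz) (inv_ne_zero (ne_zero_of_one_lt_norm hz)))⟩
    · rintro ⟨⟨v, hv, hvw⟩, hw⟩
      have hv0 : v ≠ 0 := by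
        rintro rfl
        exact hw (inv_eq_zero.1 (hvw.symm.trans hf.map_zero))
      exact ⟨v⁻¹, one_lt_norm_inv (mem_ball_zero_iff.1 hv) hv0, by simp only [inv_inv, hvw]⟩
  rw [enclosedSet, himage, sdiff_eq, compl_inter, compl_compl, compl_inv]

theorem exists_taylor_log (hf : IsInteriorConformalMap D f r₀) :
    ∃ t : ℕ → ℂ, t 0 = Real.log r₀ ∧ ∀ v : ℂ, ‖v‖ < 1 →
      ∃ Λ, HasSum (fun k => t k * v ^ k) Λ ∧ cexp Λ = dslope f 0 v := by
  have hlog : cexp (Real.log r₀) = dslope f 0 0 := by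
    rw [hf.dslope_zero, ← ofReal_exp, Real.exp_log hf.pos]
  obtain ⟨Λ, hΛd, hΛ0, hΛ⟩ := exists_log_of_differentiableOn_ball hf.differentiableOn_dslope
    (fun v hv => hf.dslope_ne_zero (mem_ball_zero_iff.1 hv)) hlog
  refine ⟨fun k => iteratedDeriv k Λ 0 / k.factorial, by simp [hΛ0], fun v hv => ?_⟩
  exact ⟨Λ v, hasSum_taylor_ball hΛd hv, hΛ v (mem_ball_zero_iff.2 hv)⟩

theorem exists_hasSum_grunskyCoeff (hf : IsInteriorConformalMap D f r₀)
    (hg : IsUnivalentAtInfinity (fun z => (f z⁻¹)⁻¹) (r₀ : ℂ)⁻¹ c) (hζ : ‖ζ‖ < 1) (hz : ‖z‖ < 1)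
    (hne : ζ ≠ z) :
    ∃ L, HasSum (fun p : ℕ+ × ℕ+ =>
        -(grunskyCoeff (r₀ : ℂ)⁻¹ c p.1 p.2 * ζ ^ (p.1 : ℕ) * z ^ (p.2 : ℕ))) L ∧
      cexp L * dslope f 0 ζ * dslope f 0 z = r₀ * ((f ζ - f z) / (ζ - z)) := by
  rcases eq_or_ne ζ 0 with rfl | hζ0
  · refine ⟨0, by simp, ?_⟩
    rw [Complex.exp_zero, one_mul, hf.dslope_zero, hf.dslope_eq_div hne.symm, hf.map_zero,
      zero_sub, zero_sub, neg_div_neg_eq]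
  rcases eq_or_ne z 0 with rfl | hz0
  · refine ⟨0, by simp, ?_⟩
    rw [Complex.exp_zero, one_mul, hf.dslope_zero, hf.dslope_eq_div hζ0, hf.map_zero,
      sub_zero, sub_zero, mul_comm]
  obtain ⟨L, hL, hexp⟩ := hg.exists_hasSum_grunskyCoeff (one_lt_norm_inv hζ hζ0)
    (one_lt_norm_inv hz hz0) (inv_injective.ne hne)
  simp only [inv_inv] at hL hexp
  refine ⟨L, hL, ?_⟩
  have hfζ := hf.map_ne_zero hζ hζ0
  have hfz := hf.map_ne_zero hz hz0
  have hsub : ζ - z ≠ 0 := sub_ne_zero.2 hne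
  have hsub' : z - ζ ≠ 0 := sub_ne_zero.2 hne.symm
  rw [hexp, hf.dslope_eq_div hζ0, hf.dslope_eq_div hz0, inv_sub_inv hfζ hfz, inv_sub_inv hζ0 hz0]
  field_simp
  ring

theorem exists_isInteriorGrunskyCoeff (hf : IsInteriorConformalMap D f r₀)
    (hg : IsUnivalentAtInfinity (fun z => (f z⁻¹)⁻¹) (r₀ : ℂ)⁻¹ c) :
    ∃ t : ℕ → ℂ, IsInteriorGrunskyCoeff f r₀ (interiorCoeff (r₀ : ℂ)⁻¹ c t) := by
  obtain ⟨t, ht0, ht⟩ := hf.exists_taylor_log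
  refine ⟨t, by rw [interiorCoeff_zero_zero, ht0], fun ζ z hζ hz hne => ?_⟩
  obtain ⟨L, hL, hexp⟩ := hf.exists_hasSum_grunskyCoeff hg hζ hz hne
  obtain ⟨Λ₁, hΛ₁, hexp₁⟩ := ht ζ hζ
  obtain ⟨Λ₂, hΛ₂, hexp₂⟩ := ht z hz
  refine ⟨_, hasSum_interiorCoeff hL hΛ₁ hΛ₂, ?_⟩
  rw [Complex.exp_sub, Complex.exp_add, Complex.exp_add, hexp₁, hexp₂, hexp, ht0, ← ofReal_exp,
    Real.exp_log hf.pos, mul_div_cancel_left₀ _ hf.ofReal_ne_zero]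

theorem zero_mem (hf : IsInteriorConformalMap D f r₀) : 0 ∈ D :=
  hf.image_eq ▸ ⟨0, Metric.mem_ball_self one_pos, hf.map_zero⟩

theorem zero_notMem_exteriorDomain (hf : IsInteriorConformalMap D f r₀) :
    0 ∉ exteriorDomain D :=
  notMem_compl_iff.2 (subset_closure hf.zero_mem)

theorem inv_exteriorDomain_subset (hf : IsInteriorConformalMap D f r₀) :
    (exteriorDomain D)⁻¹ ⊆ enclosedSet (fun z => (f z⁻¹)⁻¹) 1 := by
  rw [hf.enclosedSet_eq]
  exact subset_union_of_subset_left (inv_subset_inv.2 (compl_subset_compl.2 subset_closure)) _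

theorem volume_enclosedSet_sdiff (hf : IsInteriorConformalMap D f r₀) (hDo : IsOpen D)
    (hnull : volume (frontier D) = 0) :
    volume (enclosedSet (fun z => (f z⁻¹)⁻¹) 1 \ (exteriorDomain D)⁻¹) = 0 := by
  have h0 : 0 ∉ frontier D := fun h => (hDo.frontier_eq ▸ h).2 hf.zero_mem
  refine measure_mono_null (fun w hw => ?_)
    (measure_union_null (volume_inv_eq_zero h0 hnull) (measure_singleton (0 : ℂ)))
  rw [hf.enclosedSet_eq] at hw
  refine hw.1.imp_left fun hwD => ?_
  rw [Set.mem_inv, hDo.frontier_eq]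
  exact ⟨notMem_compl_iff.1 hw.2, hwD⟩

theorem exists_log_exteriorPartitionFn (hf : IsInteriorConformalMap D f r₀) (hDo : IsOpen D)
    (hne : (exteriorDomain D).Nonempty) (hnull : volume (frontier D) = 0) :
    ∃ (a : ℕ → ℕ → ℂ) (B : EllTwo →L[ℂ] EllTwo),
      IsInteriorGrunskyCoeff f r₀ a ∧ IsGrunskyOperator (fun k l : ℕ+ => a k l) B ∧
      ∀ n : ℕ, IntegrableOn (exteriorCoulombWeight n) (configSpace n (exteriorDomain D)) ∧
        0 < exteriorPartitionFn n (exteriorDomain D) ∧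
        (truncDet n B).im = 0 ∧ 0 < (truncDet n B).re ∧
        Real.log (exteriorPartitionFn n (exteriorDomain D)) =
          Real.log (Real.pi ^ n / n.factorial) - n * (n + 1) * Real.log r₀ +
            Real.log (truncDet n B).re := by
  obtain ⟨c, hu⟩ := hf.exists_isUnivalentAtInfinity
  obtain ⟨t, ht⟩ := hf.exists_isInteriorGrunskyCoeff hu
  have hΩo : IsOpen (exteriorDomain D) := isClosed_closure.isOpen_compl
  have h0 := hf.zero_notMem_exteriorDomain
  have hsub := hf.inv_exteriorDomain_subset
  have hb := (hu.isBounded_enclosedSet le_rfl).subset hsub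
  obtain ⟨B, hB, hlog⟩ := hu.exists_log_partitionFn (isOpen_inv_of_zero_notMem hΩo h0) hne.inv hsub
    (hf.volume_enclosedSet_sdiff hDo hnull)
  simp only [norm_inv, norm_real, Real.norm_of_nonneg hf.pos.le, Real.log_inv, mul_neg,
    ← sub_eq_add_neg, ← exteriorPartitionFn_eq _ hΩo.measurableSet h0 hb] at hlog
  refine ⟨_, B, ht, ?_, fun n =>
    ⟨integrableOn_exteriorCoulombWeight n hΩo.measurableSet h0 hb, hlog n⟩⟩
  simpa only [interiorCoeff_pnat] using hB

end IsInteriorConformalMap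

theorem proposition1p1_general (D : Set ℂ) (hDo : IsOpen D) (hDne : D.Nonempty)
    (hne : (exteriorDomain D).Nonempty) (hnull : volume (frontier D) = 0) :
    (∀ (g : ℂ → ℂ) (r : ℝ), IsExteriorConformalMap D g r →
      ∃ (a : ℕ+ → ℕ+ → ℂ) (B : EllTwo →L[ℂ] EllTwo),
        IsExteriorGrunskyCoeff g r a ∧ IsGrunskyOperator a B ∧
        ∀ n : ℕ,
          IntegrableOn (coulombWeight n) (configSpace n D) ∧
          0 < partitionFn n D ∧
          (truncDet n B).im = 0 ∧ 0 < (truncDet n B).re ∧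
          Real.log (partitionFn n D) =
            Real.log (Real.pi ^ n / (n.factorial : ℝ)) + (n : ℝ) * ((n : ℝ) + 1) * Real.log r
              + Real.log (truncDet n B).re) ∧
    (∀ (f : ℂ → ℂ) (r₀ : ℝ), IsInteriorConformalMap D f r₀ →
      ∃ (a : ℕ → ℕ → ℂ) (B₁ : EllTwo →L[ℂ] EllTwo),
        IsInteriorGrunskyCoeff f r₀ a ∧
        IsGrunskyOperator (fun k l : ℕ+ => a k l) B₁ ∧
        ∀ n : ℕ,
          IntegrableOn (exteriorCoulombWeight n) (configSpace n (exteriorDomain D)) ∧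
          0 < exteriorPartitionFn n (exteriorDomain D) ∧
          (truncDet n B₁).im = 0 ∧ 0 < (truncDet n B₁).re ∧
          Real.log (exteriorPartitionFn n (exteriorDomain D)) =
            Real.log (Real.pi ^ n / (n.factorial : ℝ)) - (n : ℝ) * ((n : ℝ) + 1) * Real.log r₀
              + Real.log (truncDet n B₁).re) :=
  ⟨fun _ _ hg => hg.exists_log_partitionFn hDo hDne hnull,
    fun _ _ hf => hf.exists_log_exteriorPartitionFn hDo hne hnull⟩

theorem proposition1p1 (D : Set ℂ) (hD : IsBoundedJordanDomain D) (h0 : (0 : ℂ) ∈ D)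
    (hnull : volume (frontier D) = 0) :
    (∀ (g : ℂ → ℂ) (r : ℝ), IsExteriorConformalMap D g r →
      ∃ (a : ℕ+ → ℕ+ → ℂ) (B : EllTwo →L[ℂ] EllTwo),
        IsExteriorGrunskyCoeff g r a ∧ IsGrunskyOperator a B ∧
        ∀ n : ℕ, 1 ≤ n →
          IntegrableOn (coulombWeight n) (configSpace n D) ∧
          0 < partitionFn n D ∧
          (truncDet n B).im = 0 ∧ 0 < (truncDet n B).re ∧
          Real.log (partitionFn n D) =
            Real.log (Real.pi ^ n / (n.factorial : ℝ)) + (n : ℝ) * ((n : ℝ) + 1) * Real.log r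
              + Real.log (truncDet n B).re) ∧
    (∀ (f : ℂ → ℂ) (r₀ : ℝ), IsInteriorConformalMap D f r₀ →
      ∃ (a : ℕ → ℕ → ℂ) (B₁ : EllTwo →L[ℂ] EllTwo),
        IsInteriorGrunskyCoeff f r₀ a ∧
        IsGrunskyOperator (fun k l : ℕ+ => a k l) B₁ ∧
        ∀ n : ℕ, 1 ≤ n →
          IntegrableOn (exteriorCoulombWeight n) (configSpace n (exteriorDomain D)) ∧
          0 < exteriorPartitionFn n (exteriorDomain D) ∧
          (truncDet n B₁).im = 0 ∧ 0 < (truncDet n B₁).re ∧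
          Real.log (exteriorPartitionFn n (exteriorDomain D)) =
            Real.log (Real.pi ^ n / (n.factorial : ℝ)) - (n : ℝ) * ((n : ℝ) + 1) * Real.log r₀
              + Real.log (truncDet n B₁).re) := by
  obtain ⟨hDo, -, hDb, -⟩ := hD
  have hne : (exteriorDomain D).Nonempty := Set.nonempty_compl.2 fun h =>
    NormedSpace.unbounded_univ ℂ ℂ (h ▸ hDb.closure)
  obtain ⟨hexterior, hinterior⟩ := proposition1p1_general D hDo ⟨0, h0⟩ hne hnull
  refine ⟨fun g r hg => ?_, fun f r₀ hf => ?_⟩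
  · obtain ⟨a, B, ha, hB, h⟩ := hexterior g r hg
    exact ⟨a, B, ha, hB, fun n _ => h n⟩
  · obtain ⟨a, B, ha, hB, h⟩ := hinterior f r₀ hf
    exact ⟨a, B, ha, hB, fun n _ => h n⟩
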